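/- Let $M$ be a smooth (Hausdorff, second countable) manifold of dimension $2n$ without boundary, $\omega$ a smooth symplectic form on $M$, and $V\subset TM$ a smooth distribution of rank $2k$ which is symplectic, i.e. $\omega_x$ is nondegenerate on $V_x$ for every $x\in M$; $V$ may be integrable or not. Let $\pi_V:TM\to TM$ be the projection onto $V$ along the symplectic complement $V^\perp$. For $H\in C^\infty(M)$ let $X_H$ be the Hamiltonian vector field, $i_{X_H}\omega=-dH$, put $X_H^V=\pi_V(X_H)$, and let $$\mathfrak C_H=\{x\in M : X_H^V(x)=0\}$$ be the critical set of the constrained Hamiltonian system $(M,\omega,H,V)$. (1) Let $H\in C^\infty(M)$, and let $Y_1,\dots,Y_{2k}$ be a smooth local frame of $V$ over an open set $U\subset M$. Put $F=(Y_1(H),\dots,Y_{2k}(H)):U\to\mathbb R^{2k}$. Then $\mathfrak C_H\cap U=F^{-1}(0)$; Lebesgue-almost every $c\in\mathbb R^{2k}$ is a regular value of $F$; and for every regular value $c$ of $F$ the level set $F^{-1}(c)$ is a (possibly empty) embedded smooth submanifold of dimension $2(n-k)$. (2) Let $\mathcal G_V$ be the set of all $H\in C^\infty(M)$ such that, for every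 smooth local frame $Y_1,\dots,Y_{2k}$ of $V$, $0$ is a regular value of $(Y_1(H),\dots,Y_{2k}(H))$. Then $\mathcal G_V$ is open and dense in $C^\infty(M)$ with the (strong) Whitney $C^\infty$ topology, and for every $H\in\mathcal G_V$ the critical set $\mathfrak C_H$ is a (possibly empty) embedded smooth submanifold of $M$ of dimension $2(n-k)$. In this sense the critical set is, generically, a smooth submanifold of dimension $2(n-k)$. -/

import Mathlib

open scoped Manifold ContDiff Topology

noncomputable section

namespace ConstrainedHamiltonian

/-- A symplectic form on a smooth `2n`-manifold `M`: a smooth `2`-form which is nondegenerate at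
every point and closed. -/
structure SymplecticForm (n : ℕ) (M : Type*) [TopologicalSpace M]
    [ChartedSpace (EuclideanSpace ℝ (Fin (2 * n))) M] [IsManifold (𝓡 (2 * n)) ∞ M] where
  /-- the form `Ω_x` on the tangent space at `x` -/
  form (x : M) : TangentSpace (𝓡 (2 * n)) x →L[ℝ] TangentSpace (𝓡 (2 * n)) x →L[ℝ] ℝ
  alternating (x : M) (v : TangentSpace (𝓡 (2 * n)) x) : form x v v = 0
  nondegenerate (x : M) (v : TangentSpace (𝓡 (2 * n)) x) : (∀ w, form x v w = 0) → v = 0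
  smooth : ContMDiff (𝓡 (2 * n))
    ((𝓡 (2 * n)).prod 𝓘(ℝ, EuclideanSpace ℝ (Fin (2 * n)) →L[ℝ]
      EuclideanSpace ℝ (Fin (2 * n)) →L[ℝ] ℝ)) ∞
    (fun x ↦ Bundle.TotalSpace.mk' (EuclideanSpace ℝ (Fin (2 * n)) →L[ℝ]
      EuclideanSpace ℝ (Fin (2 * n)) →L[ℝ] ℝ) x (form x))
  /-- `dΩ = 0`. For constant vector fields `u, v, w` on the target of a chart `e`, and `Ωe` the
  expression of `Ω` in this chart, `dΩe (u, v, w)` is the cyclic sum of the derivatives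
  `∂_u (Ωe (v, w))`. -/
  closed (x₀ : M) (y : EuclideanSpace ℝ (Fin (2 * n)))
      (_ : y ∈ (chartAt (EuclideanSpace ℝ (Fin (2 * n))) x₀).target)
      (u v w : EuclideanSpace ℝ (Fin (2 * n))) :
    let e := chartAt (EuclideanSpace ℝ (Fin (2 * n))) x₀
    let Ωe : EuclideanSpace ℝ (Fin (2 * n)) → EuclideanSpace ℝ (Fin (2 * n)) →
        EuclideanSpace ℝ (Fin (2 * n)) → ℝ := fun z a b ↦
      form (e.symm z) (mfderiv (𝓡 (2 * n)) (𝓡 (2 * n)) e.symm z a)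
        (mfderiv (𝓡 (2 * n)) (𝓡 (2 * n)) e.symm z b)
    fderiv ℝ (fun z ↦ Ωe z v w) y u + fderiv ℝ (fun z ↦ Ωe z w u) y v
      + fderiv ℝ (fun z ↦ Ωe z u v) y w = 0

section

variable {n : ℕ} {M : Type*} [TopologicalSpace M]
  [ChartedSpace (EuclideanSpace ℝ (Fin (2 * n))) M] [IsManifold (𝓡 (2 * n)) ∞ M]

instance (x : M) : FiniteDimensional ℝ (TangentSpace (𝓡 (2 * n)) x) :=
  inferInstanceAs (FiniteDimensional ℝ (EuclideanSpace ℝ (Fin (2 * n))))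

namespace SymplecticForm

variable (Ω : SymplecticForm n M)

/-- `Ω_x` as a bilinear form. -/
def bilin (x : M) : LinearMap.BilinForm ℝ (TangentSpace (𝓡 (2 * n)) x) :=
  LinearMap.mk₂ ℝ (fun v w ↦ Ω.form x v w) (by simp) (by simp) (by simp) (by simp)

@[simp]
lemma bilin_apply (x : M) (v w : TangentSpace (𝓡 (2 * n)) x) :
    Ω.bilin x v w = Ω.form x v w := rfl

lemma bilin_isAlt (x : M) : (Ω.bilin x).IsAlt := Ω.alternating x

lemma bilin_isRefl (x : M) : (Ω.bilin x).IsRefl := (Ω.bilin_isAlt x).isRefl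

lemma bilin_nondegenerate (x : M) : (Ω.bilin x).Nondegenerate :=
  (Ω.bilin_isRefl x).nondegenerate_iff_separatingLeft.2 fun v hv ↦ Ω.nondegenerate x v hv

end SymplecticForm

/-- The differential `dH_x` as a linear functional on the tangent space at `x`. -/
def differential (H : C^∞⟮𝓡 (2 * n), M; 𝓘(ℝ, ℝ), ℝ⟯) (x : M) :
    Module.Dual ℝ (TangentSpace (𝓡 (2 * n)) x) :=
  (show TangentSpace (𝓡 (2 * n)) x →L[ℝ] ℝ from
    mfderiv (𝓡 (2 * n)) 𝓘(ℝ, ℝ) H x).toLinearMap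

/-- The Hamiltonian vector field `X_H`, i.e. the solution of `i_{X_H} Ω = -dH`. -/
def hamiltonianVectorField (Ω : SymplecticForm n M) (H : C^∞⟮𝓡 (2 * n), M; 𝓘(ℝ, ℝ), ℝ⟯) (x : M) :
    TangentSpace (𝓡 (2 * n)) x :=
  ((Ω.bilin x).toDual (Ω.bilin_nondegenerate x)).symm (-differential H x)

/-- `Y` is a smooth family of `r` vector fields over the open set `U` which, at every `x ∈ U`, is a
basis of the fibre `W x` of the family of subspaces `W`. -/
structure IsLocalFrame {r : ℕ} (W : (x : M) → Submodule ℝ (TangentSpace (𝓡 (2 * n)) x)) (U : Set M)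
    (Y : Fin r → (x : M) → TangentSpace (𝓡 (2 * n)) x) : Prop where
  isOpen : IsOpen U
  smooth (i : Fin r) : ContMDiffOn (𝓡 (2 * n)) (𝓡 (2 * n)).tangent ∞
    (fun x ↦ (⟨x, Y i x⟩ : TangentBundle (𝓡 (2 * n)) M)) U
  linearIndependent (x : M) (_ : x ∈ U) : LinearIndependent ℝ (fun i ↦ Y i x)
  span_eq (x : M) (_ : x ∈ U) : Submodule.span ℝ (Set.range fun i ↦ Y i x) = W x

/-- A smooth symplectic distribution of rank `2k`. It need not be integrable. -/
structure SymplecticDistribution (Ω : SymplecticForm n M) (k : ℕ) where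
  /-- the fibre `V_x` -/
  fibre (x : M) : Submodule ℝ (TangentSpace (𝓡 (2 * n)) x)
  smooth (x : M) : ∃ (U : Set M) (Y : Fin (2 * k) → (x : M) → TangentSpace (𝓡 (2 * n)) x),
    x ∈ U ∧ IsLocalFrame fibre U Y
  symplectic (x : M) : ((Ω.bilin x).restrict (fibre x)).Nondegenerate

namespace SymplecticDistribution

variable {Ω : SymplecticForm n M} {k : ℕ} (V : SymplecticDistribution Ω k)

/-- The symplectic complement `V_x^⊥` of `V_x`. -/
def perp (x : M) : Submodule ℝ (TangentSpace (𝓡 (2 * n)) x) := (Ω.bilin x).orthogonal (V.fibre x)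

lemma isCompl (x : M) : IsCompl (V.fibre x) (V.perp x) :=
  LinearMap.BilinForm.isCompl_orthogonal_of_restrict_nondegenerate
    (Ω.bilin_isRefl x) (V.symplectic x)

/-- The `Ω`-orthogonal projector `π_V`: the projection onto `V` along `V^⊥`. -/
def proj (x : M) : TangentSpace (𝓡 (2 * n)) x →ₗ[ℝ] TangentSpace (𝓡 (2 * n)) x :=
  (V.fibre x).projection (V.perp x) (V.isCompl x)

/-- The vector field `X_H^V = π_V (X_H)` of the constrained Hamiltonian system. -/
def constrainedVectorField (H : C^∞⟮𝓡 (2 * n), M; 𝓘(ℝ, ℝ), ℝ⟯) (x : M) :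
    TangentSpace (𝓡 (2 * n)) x :=
  V.proj x (hamiltonianVectorField Ω H x)

/-- The critical set of the constrained Hamiltonian system `(M, Ω, H, V)`. -/
def criticalSet (H : C^∞⟮𝓡 (2 * n), M; 𝓘(ℝ, ℝ), ℝ⟯) : Set M :=
  {x | V.constrainedVectorField H x = 0}

end SymplecticDistribution

/-- The map `F = (Y_1(H), …, Y_r(H))`. -/
def frameMap {r : ℕ} (Y : Fin r → (x : M) → TangentSpace (𝓡 (2 * n)) x)
    (H : C^∞⟮𝓡 (2 * n), M; 𝓘(ℝ, ℝ), ℝ⟯) (x : M) : Fin r → ℝ :=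
  fun i ↦ differential H x (Y i x)

/-- `c` is a regular value of the restriction of `F` to the open set `U`: the differential of `F` is
surjective at every point of `U` where `F` takes the value `c`. -/
def IsRegularValueOn {r : ℕ} (F : M → Fin r → ℝ) (U : Set M) (c : Fin r → ℝ) : Prop :=
  ∀ x ∈ U, F x = c → Function.Surjective (mfderiv (𝓡 (2 * n)) 𝓘(ℝ, Fin r → ℝ) F x)

/-- `S` is a (possibly empty) embedded smooth submanifold of `M` of dimension `d`: around every point
of `S` there is a smooth chart of `M` in which `S` is the slice where all coordinates but the first
`d` vanish. -/
def IsSmoothSubmanifold (d : ℕ) (S : Set M) : Prop :=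
  ∀ x ∈ S, ∃ e ∈ IsManifold.maximalAtlas (𝓡 (2 * n)) ∞ M, x ∈ e.source ∧
    ∀ y ∈ e.source, y ∈ S ↔ ∀ j : Fin (2 * n), d ≤ (j : ℕ) → e y j = 0

/-- The basic neighbourhood of `f` in the Whitney topology: all `g` such that, for every `i`, the
derivatives of `g - f` up to order `r`, computed in the chart `e i`, are smaller than `ε i` on
`K i`. -/
def whitneyNhd (r : ℕ) (e : ℕ → OpenPartialHomeomorph M (EuclideanSpace ℝ (Fin (2 * n))))
    (K : ℕ → Set M) (ε : ℕ → ℝ) (f : C^∞⟮𝓡 (2 * n), M; 𝓘(ℝ, ℝ), ℝ⟯) :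
    Set C^∞⟮𝓡 (2 * n), M; 𝓘(ℝ, ℝ), ℝ⟯ :=
  {g | ∀ i, ∀ x ∈ K i, ∀ j ≤ r,
    ‖iteratedFDeriv ℝ j (g ∘ (e i).symm) (e i x) - iteratedFDeriv ℝ j (f ∘ (e i).symm) (e i x)‖
      < ε i}

/-- The (strong) Whitney `C^∞` topology on the space of smooth functions on `M`. -/
@[reducible]
def whitneyTopology : TopologicalSpace C^∞⟮𝓡 (2 * n), M; 𝓘(ℝ, ℝ), ℝ⟯ :=
  TopologicalSpace.generateFrom
    {N | ∃ (r : ℕ) (e : ℕ → OpenPartialHomeomorph M (EuclideanSpace ℝ (Fin (2 * n))))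
        (K : ℕ → Set M) (ε : ℕ → ℝ) (f : C^∞⟮𝓡 (2 * n), M; 𝓘(ℝ, ℝ), ℝ⟯),
      (∀ i, e i ∈ IsManifold.maximalAtlas (𝓡 (2 * n)) ∞ M) ∧
      (∀ i, IsCompact (K i) ∧ K i ⊆ (e i).source) ∧ LocallyFinite K ∧ (∀ i, 0 < ε i) ∧
      N = whitneyNhd r e K ε f}

/-- The generic Hamiltonians for `V`: for every local frame `Y` of `V`, the value `0` is a regular
value of `(Y_1(H), …, Y_{2k}(H))`. -/
def SymplecticDistribution.genericHamiltonians {Ω : SymplecticForm n M} {k : ℕ}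
    (V : SymplecticDistribution Ω k) : Set C^∞⟮𝓡 (2 * n), M; 𝓘(ℝ, ℝ), ℝ⟯ :=
  {H | ∀ (U : Set M) (Y : Fin (2 * k) → (x : M) → TangentSpace (𝓡 (2 * n)) x),
    IsLocalFrame V.fibre U Y → IsRegularValueOn (n := n) (frameMap Y H) U 0}

end

end ConstrainedHamiltonian

end

/-! Since `Ω(X_H, v) = -dH(v)`, the vector `π_V (X_H)` vanishes at `x` exactly when `dH_x` kills
`V_x`. Over a frame the critical set is therefore the zero set of `F = (Y_1(H), …, Y_{2k}(H))`, and
the claims about a fixed `H` follow from Sard's theorem and the inverse function theorem. Sard's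
theorem is proved for real functions by induction on the dimension of the source, very flat points
being handled by Hausdorff dimension, and then for maps into `ℝᵖ` by induction on `p` and Fubini.

For genericity, fix a chart and a linear map `L` onto `ℝ^{2k}` which is injective on `V_x`. Near `x`
there is a unique frame of `V` dual to `L`; `normalizedPairing` differentiates `H` along it. It
depends only on `H`, `V` and `L`, it has the same regular zeros as `F`, and adding `∑ t_j L_j` to
`H` translates it by exactly `t`. So the perturbed function is regular at zero as soon as `-t` is a
regular value of the unperturbed map, which holds for almost every `t` by Sard.

Openness: on a compact set, regularity survives perturbations that are small in `C²`; a locally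
finite cover by compact sets turns this into a Whitney neighbourhood. Density: the `L_j` are cut off
by bump functions and `H` is corrected on one set of the cover after another by small perturbations.
`IsPerturbationStable` isolates the two properties which Whitney neighbourhoods and the sets
`regularOn K` share, namely stability under small compactly supported perturbations and under
locally eventually constant limits. They keep the sequence and its limit inside the neighbourhood
and preserve regularity already gained. -/

open MeasureTheory Module

/-! ### Two tools: openness of surjectivity and countable localization of null images. -/

/-- Surjectivity is an open condition on continuous linear maps onto a finite-dimensional space. -/
theorem ContinuousLinearMap.isOpen_setOf_surjective_of_finiteDimensional
    (E F : Type*) [NormedAddCommGroup E] [NormedSpace ℝ E] [NormedAddCommGroup F] [NormedSpace ℝ F]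
    [FiniteDimensional ℝ F] : IsOpen {T : E →L[ℝ] F | Function.Surjective T} := by
  refine isOpen_iff_mem_nhds.2 fun T hT ↦ ?_
  obtain ⟨R, hR⟩ := (T : E →ₗ[ℝ] F).exists_rightInverse_of_surjective (LinearMap.range_eq_top.2 hT)
  let R' : F →L[ℝ] E := LinearMap.toContinuousLinearMap R
  have : CompleteSpace F := FiniteDimensional.complete ℝ F
  -- If `S ∘ R'` is invertible then `S` is surjective, and invertibility is open; for `S = T` the
  -- composite is the identity.
  have ho : IsOpen {S : E →L[ℝ] F |
      S ∘L R' ∈ Set.range (ContinuousLinearEquiv.toContinuousLinearMap (σ₁₂ := RingHom.id ℝ)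
        (M₁ := F) (M₂ := F))} :=
    ContinuousLinearEquiv.isOpen.preimage (by fun_prop)
  refine Filter.mem_of_superset (ho.mem_nhds ⟨.refl ℝ F, ?_⟩) ?_
  · ext v
    exact (LinearMap.congr_fun hR v).symm
  · rintro S ⟨A, hA⟩ y
    obtain ⟨z, rfl⟩ := A.surjective y
    exact ⟨R' z, (DFunLike.congr_fun hA z).symm⟩

/-- The image of a set is null as soon as the image is locally null. -/
theorem MeasureTheory.measure_image_null_of_locally_null {X Y : Type*} [TopologicalSpace X]
    [SecondCountableTopology X] [MeasurableSpace Y] {μ : Measure Y} {f : X → Y} {s : Set X}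
    (h : ∀ x ∈ s, ∃ t ∈ 𝓝 x, μ (f '' (s ∩ t)) = 0) : μ (f '' s) = 0 := by
  choose! t ht hμ using h
  obtain ⟨c, hcs, hc, hs⟩ := TopologicalSpace.countable_cover_nhdsWithin
    (fun x hx ↦ mem_nhdsWithin_of_mem_nhds (ht x hx))
  refine measure_mono_null (t := ⋃ x ∈ c, f '' (s ∩ t x)) ?_
    ((measure_biUnion_null_iff hc).2 fun x hx ↦ hμ x (hcs hx))
  rintro _ ⟨x, hx, rfl⟩
  obtain ⟨y, hy, hxy⟩ := Set.mem_iUnion₂.1 (hs hx)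
  exact Set.mem_iUnion₂.2 ⟨y, hy, x, ⟨hx, hxy⟩, rfl⟩

/-! ### Inverse function theorem and coordinates adapted to one function. -/

section Charts

variable {E F : Type*} [NormedAddCommGroup E] [NormedSpace ℝ E] [CompleteSpace E]
  [NormedAddCommGroup F] [NormedSpace ℝ F]

/-- The inverse function theorem: a smooth map with invertible derivative at `a` restricts to a
smooth open partial homeomorphism with smooth inverse. -/
theorem ContDiffOn.exists_openPartialHomeomorph {f : E → F} {O : Set E} (hO : IsOpen O)
    (hf : ContDiffOn ℝ ∞ f O) {a : E} (ha : a ∈ O) (f' : E ≃L[ℝ] F)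
    (hf' : HasFDerivAt f (f' : E →L[ℝ] F) a) :
    ∃ T : OpenPartialHomeomorph E F, a ∈ T.source ∧ T.source ⊆ O ∧ (T : E → F) = f ∧
      ContDiffOn ℝ ∞ T.symm T.target := by
  have hfa := hf.contDiffAt (hO.mem_nhds ha)
  let T₀ := hfa.toOpenPartialHomeomorph f hf' (by simp)
  -- The inverse is smooth at each image of a point with invertible derivative, so the source is
  -- shrunk to the open set of such points.
  let O' := O ∩ fderiv ℝ f ⁻¹' Set.range (ContinuousLinearEquiv.toContinuousLinearMap
    (σ₁₂ := RingHom.id ℝ) (M₁ := E) (M₂ := F))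
  have hO' : IsOpen O' := (hf.continuousOn_fderiv_of_isOpen hO (by simp)).isOpen_inter_preimage hO
    ContinuousLinearEquiv.isOpen
  refine ⟨T₀.restrOpen O' hO', ⟨hfa.mem_toOpenPartialHomeomorph_source hf' (by simp), ha, f',
    hf'.fderiv.symm⟩, fun x hx ↦ hx.2.1, rfl, fun y hy ↦ ?_⟩
  have hy' : (T₀.restrOpen O' hO').symm y ∈ (T₀.restrOpen O' hO').source :=
    (T₀.restrOpen O' hO').map_target hy
  obtain ⟨-, hyO, A, hA⟩ := hy'
  have hfy := hf.contDiffAt (hO.mem_nhds hyO)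
  refine ((T₀.restrOpen O' hO').contDiffAt_symm (f₀' := A) hy ?_ hfy).contDiffWithinAt
  rw [hA]
  exact (hfy.differentiableAt (by simp)).hasFDerivAt

/-- A smooth function with nonzero derivative is the first coordinate of a smooth chart. -/
theorem ContDiffOn.exists_chart_fst_eq [FiniteDimensional ℝ E] {w : E → ℝ} {O : Set E}
    (hO : IsOpen O) (hw : ContDiffOn ℝ ∞ w O) {a : E} (ha : a ∈ O) (hwa : fderiv ℝ w a ≠ 0) :
    ∃ E' : Submodule ℝ E, finrank ℝ E' + 1 = finrank ℝ E ∧ ∃ T : OpenPartialHomeomorph E (ℝ × E'),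
      a ∈ T.source ∧ T.source ⊆ O ∧ (∀ x, (T x).1 = w x) ∧ ContDiffOn ℝ ∞ T.symm T.target := by
  set w' := fderiv ℝ w a with hw'
  obtain ⟨v, hv⟩ : ∃ v, w' v ≠ 0 := by
    by_contra! h
    exact hwa (ContinuousLinearMap.ext h)
  let R : ℝ →L[ℝ] E := ContinuousLinearMap.toSpanSingleton ℝ ((w' v)⁻¹ • v)
  have hR : Function.RightInverse R w' := fun t ↦ by simp [R, hv]
  let A := ContinuousLinearEquiv.equivOfRightInverse w' R hR
  refine ⟨w'.ker, ?_, ?_⟩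
  · have h := A.toLinearEquiv.finrank_eq
    rw [finrank_prod, finrank_self] at h
    omega
  -- The linear splitting `A` of `E` along `w'` with its first component replaced by `w`; its
  -- derivative at `a` is still `A`.
  · let f : E → ℝ × w'.ker := fun x ↦ (w x, (A x).2)
    have hwd : HasFDerivAt w w' a :=
      ((hw.contDiffAt (hO.mem_nhds ha)).differentiableAt (by simp)).hasFDerivAt
    have hfd : HasFDerivAt f (A : E →L[ℝ] ℝ × w'.ker) a :=
      hwd.prodMk ((ContinuousLinearMap.snd ℝ ℝ w'.ker).comp (A : E →L[ℝ] ℝ × w'.ker)).hasFDerivAt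
    have hfs : ContDiffOn ℝ ∞ f O := hw.prodMk
      ((ContinuousLinearMap.snd ℝ ℝ w'.ker).comp (A : E →L[ℝ] ℝ × w'.ker)).contDiff.contDiffOn
    obtain ⟨T, h1, h2, h3, h4⟩ := hfs.exists_openPartialHomeomorph hO ha A hfd
    exact ⟨T, h1, h2, fun x ↦ by rw [h3], h4⟩

end Charts

/-! ### Sard's theorem for real-valued functions. -/

section SardReal

variable {E : Type*} [NormedAddCommGroup E] [NormedSpace ℝ E]

/-- A function whose derivatives of order `1, …, N` vanish at `x` and whose derivative of order
`N + 1` is bounded near `x` is Taylor-small of order `N + 1` at `x`. -/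
theorem norm_iteratedFDeriv_le_of_iteratedFDeriv_eq_zero {F : Type*} [NormedAddCommGroup F]
    [NormedSpace ℝ F] {f : E → F} {B : Set E} (hB : Convex ℝ B) (hf : ∀ y ∈ B, ContDiffAt ℝ ∞ f y)
    {C : ℝ} {N : ℕ} (hC : ∀ y ∈ B, ‖iteratedFDeriv ℝ (N + 1) f y‖ ≤ C) {x : E} (hx : x ∈ B)
    (h0 : ∀ j, 1 ≤ j → j ≤ N → iteratedFDeriv ℝ j f x = 0) (i : ℕ) (hi : i ≤ N) :
    ∀ y ∈ B, ‖iteratedFDeriv ℝ (N + 1 - i) f y‖ ≤ C * ‖y - x‖ ^ i := by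
  induction i with
  | zero => simpa using hC
  | succ i ih =>
    intro y hy
    have hC0 : 0 ≤ C := (norm_nonneg _).trans (hC x hx)
    have hsub : segment ℝ x y ⊆ B := hB.segment_subset hx hy
    have hle : ∀ z ∈ segment ℝ x y, ‖z - x‖ ≤ ‖y - x‖ := by
      rintro z hz
      obtain ⟨t, ⟨ht0, ht1⟩, rfl⟩ := (segment_eq_image_lineMap ℝ x y).subset hz
      rw [AffineMap.lineMap_apply, vsub_eq_sub, vadd_eq_add, add_sub_cancel_right, norm_smul,
        Real.norm_of_nonneg ht0]
      exact mul_le_of_le_one_left (norm_nonneg _) ht1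
    -- The derivative of order `N - i` vanishes at `x`, so the mean value inequality on the segment
    -- from `x` lowers the order by one and gains a factor `‖y - x‖`.
    have key := (convex_segment x y).norm_image_sub_le_of_norm_fderiv_le (𝕜 := ℝ)
      (f := iteratedFDeriv ℝ (N + 1 - (i + 1)) f) (C := C * ‖y - x‖ ^ i) (x := x) (y := y)
      (fun z hz ↦ (hf z (hsub hz)).differentiableAt_iteratedFDeriv 
        (WithTop.coe_lt_coe.2 (ENat.natCast_lt_top _)))
      (fun z hz ↦ by
        rw [norm_fderiv_iteratedFDeriv, show N + 1 - (i + 1) + 1 = N + 1 - i by omega]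
        refine (ih (by omega) z (hsub hz)).trans ?_
        gcongr
        exact hle z hz)
      (left_mem_segment ℝ x y) (right_mem_segment ℝ x y)
    rw [h0 _ (by omega) (by omega), sub_zero] at key
    rwa [pow_succ, ← mul_assoc]

variable [FiniteDimensional ℝ E]

/-- The image of the set where all derivatives up to a large order vanish is null. -/
theorem volume_image_flat_eq_zero {f : E → ℝ} {U : Set E} (hU : IsOpen U)
    (hf : ContDiffOn ℝ ∞ f U) :
    volume (f '' {x ∈ U | ∀ j, 1 ≤ j → j ≤ finrank ℝ E → iteratedFDeriv ℝ j f x = 0}) = 0 := by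
  set m := finrank ℝ E
  set s := {x ∈ U | ∀ j, 1 ≤ j → j ≤ m → iteratedFDeriv ℝ j f x = 0}
  have hat : ∀ y ∈ U, ContDiffAt ℝ ∞ f y := fun y hy ↦ hf.contDiffAt (hU.mem_nhds hy)
  -- Taylor smallness makes `f` locally Hölder of exponent `m + 1` on `s`, so the image has
  -- dimension at most `m / (m + 1) < 1` and is null in `ℝ`.
  have hdim : dimH (f '' s) ≤ dimH s / ((m + 1 : ℕ) : NNReal) := by
    refine dimH_image_le_of_locally_holder_on (by positivity) fun x hx ↦ ?_
    have hcont : ContinuousAt (iteratedFDeriv ℝ (m + 1) f) x :=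
      ((hat x hx.1).iteratedFDeriv_right (m := 0) (i := m + 1) (by simp; exact_mod_cast le_top)).continuousAt
    have hbdd : ∀ᶠ y in 𝓝 x, ‖iteratedFDeriv ℝ (m + 1) f y‖ < ‖iteratedFDeriv ℝ (m + 1) f x‖ + 1 :=
      hcont.norm.eventually_lt continuousAt_const (by simp)
    obtain ⟨δ, hδ, hball⟩ := Metric.eventually_nhds_iff_ball.1 (hbdd.and (hU.mem_nhds hx.1))
    set C : ℝ := ‖iteratedFDeriv ℝ (m + 1) f x‖ + 1
    have hC : 0 ≤ C := by positivity
    refine ⟨C.toNNReal, s ∩ Metric.ball x δ,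
      Filter.inter_mem self_mem_nhdsWithin (mem_nhdsWithin_of_mem_nhds (Metric.ball_mem_nhds x hδ)),
      fun y hy z hz ↦ ?_⟩
    have h1 := norm_iteratedFDeriv_le_of_iteratedFDeriv_eq_zero (convex_ball x δ)
      (fun y hy ↦ hat y (hball y hy).2) (fun y hy ↦ (hball y hy).1.le) hy.2 hy.1.2 m le_rfl
    have hsub : segment ℝ y z ⊆ Metric.ball x δ := (convex_ball x δ).segment_subset hy.2 hz.2
    have key := (convex_segment y z).norm_image_sub_le_of_norm_fderiv_le (𝕜 := ℝ)
      (f := f) (C := C * ‖z - y‖ ^ m) (x := y) (y := z)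
      (fun u hu ↦ (hat u (hball u (hsub hu)).2).differentiableAt (by simp))
      (fun u hu ↦ by
        have := h1 u (hsub hu)
        rw [show m + 1 - m = 1 by omega, norm_iteratedFDeriv_one] at this
        refine this.trans ?_
        gcongr
        obtain ⟨t, ⟨ht0, ht1⟩, rfl⟩ := (segment_eq_image_lineMap ℝ y z).subset hu
        rw [AffineMap.lineMap_apply, vsub_eq_sub, vadd_eq_add, add_sub_cancel_right, norm_smul,
          Real.norm_of_nonneg ht0]
        exact mul_le_of_le_one_left (norm_nonneg _) ht1)
      (left_mem_segment ℝ y z) (right_mem_segment ℝ y z)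
    rw [edist_comm, edist_comm y z, edist_dist, edist_dist, dist_eq_norm, dist_eq_norm,
      show ((C.toNNReal : NNReal) : ENNReal) = ENNReal.ofReal C from rfl]
    rw [NNReal.coe_natCast, ENNReal.rpow_natCast, ← ENNReal.ofReal_pow (norm_nonneg _),
      ← ENNReal.ofReal_mul hC]
    refine ENNReal.ofReal_le_ofReal (key.trans (le_of_eq ?_))
    ring
  have hlt : dimH (f '' s) < ((1 : NNReal) : ENNReal) := by
    refine hdim.trans_lt ?_
    have h2 : dimH s ≤ (m : ENNReal) := (dimH_mono (Set.subset_univ s)).trans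
      (Real.dimH_univ_eq_finrank E).le
    refine (ENNReal.div_le_div_right h2 _).trans_lt ?_
    rw [ENNReal.div_lt_iff (by simp) (by simp)]
    simp
    exact_mod_cast Nat.lt_succ_self m
  refine measure_zero_of_dimH_lt (d := 1) ?_ hlt
  rw [NNReal.coe_one, hausdorffMeasure_real]

/-- **Sard's theorem** for real-valued functions. -/
theorem volume_image_fderiv_eq_zero {f : E → ℝ} {U : Set E} (hU : IsOpen U)
    (hf : ContDiffOn ℝ ∞ f U) : volume (f '' {x ∈ U | fderiv ℝ f x = 0}) = 0 := by
  induction h : finrank ℝ E generalizing E with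
  | zero =>
    have : Subsingleton E := finrank_zero_iff.1 h
    exact ((Set.subsingleton_of_subsingleton (s := {x ∈ U | fderiv ℝ f x = 0})).image f).measure_zero _
  | succ m ih =>
    have hat : ∀ y ∈ U, ContDiffAt ℝ ∞ f y := fun y hy ↦ hf.contDiffAt (hU.mem_nhds hy)
    -- A critical point that is not flat lies in `s i`, where `i + 1` is the least positive order of
    -- a nonvanishing derivative. This order is not `1` because the point is critical, so `i ≥ 1`
    -- and the `i`-th derivative vanishes by minimality.
    let s : ℕ → Set E := fun i ↦ {x ∈ U | fderiv ℝ f x = 0 ∧ iteratedFDeriv ℝ i f x = 0 ∧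
      iteratedFDeriv ℝ (i + 1) f x ≠ 0}
    have hcover : {x ∈ U | fderiv ℝ f x = 0} ⊆
        {x ∈ U | ∀ j, 1 ≤ j → j ≤ finrank ℝ E → iteratedFDeriv ℝ j f x = 0} ∪ ⋃ i, s i := by
      intro x hx
      by_cases hflat : ∀ j, 1 ≤ j → j ≤ finrank ℝ E → iteratedFDeriv ℝ j f x = 0
      · exact Or.inl ⟨hx.1, hflat⟩
      · push Not at hflat
        have hex : ∃ j, 1 ≤ j ∧ iteratedFDeriv ℝ j f x ≠ 0 := by
          obtain ⟨j, h1, -, h2⟩ := hflat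
          exact ⟨j, h1, h2⟩
        classical
        have hj := Nat.find_spec hex
        have h1 : Nat.find hex ≠ 1 := fun h1 ↦ by
          rw [h1, ← norm_ne_zero_iff, norm_iteratedFDeriv_one, hx.2] at hj
          simp at hj
        have hmin := Nat.find_min hex (m := Nat.find hex - 1) (by omega)
        refine Or.inr (Set.mem_iUnion.2 ⟨Nat.find hex - 1, hx.1, hx.2, ?_, ?_⟩)
        · by_contra h0
          exact hmin ⟨by omega, h0⟩
        · rw [Nat.sub_add_cancel hj.1]
          exact hj.2
    refine measure_mono_null (Set.image_mono hcover) ?_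
    rw [Set.image_union, Set.image_iUnion]
    refine measure_union_null (volume_image_flat_eq_zero hU hf) (measure_iUnion_null fun i ↦ ?_)
    refine measure_image_null_of_locally_null fun a ha ↦ ?_
    obtain ⟨haU, -, -, hne⟩ := ha
    have hsm : ContDiffOn ℝ ∞ (iteratedFDeriv ℝ i f) U := fun y hy ↦
      ((hat y hy).iteratedFDeriv_right (m := ∞) (i := i) (by norm_cast)).contDiffWithinAt
    have hsmat := (hsm.contDiffAt (hU.mem_nhds haU)).differentiableAt (by simp)
    obtain ⟨v, hv⟩ : ∃ v, fderiv ℝ (fun x ↦ iteratedFDeriv ℝ i f x v) a ≠ 0 := by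
      by_contra! hall
      refine hne ?_
      have h0 : fderiv ℝ (iteratedFDeriv ℝ i f) a = 0 := by
        ext u v
        have := DFunLike.congr_fun (hall v) u
        rw [fderiv_continuousMultilinear_apply_const_apply hsmat] at this
        simpa using this
      ext m
      rw [iteratedFDeriv_succ_apply_left, h0]
      rfl
    have hwsm : ContDiffOn ℝ ∞ (fun x ↦ iteratedFDeriv ℝ i f x v) U :=
      (ContinuousMultilinearMap.apply ℝ (fun _ : Fin i ↦ E) ℝ v).contDiff.comp_contDiffOn hsm
    -- Near `a`, the set `s i` lies in the hypersurface where this component of the `i`-th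
    -- derivative is zero. Critical points of `f` remain critical for its restriction there, and the
    -- dimension has dropped by one.
    obtain ⟨E', hE', T, haT, hTU, hT1, hTs⟩ := hwsm.exists_chart_fst_eq hU haU hv
    refine ⟨T.source, T.open_source.mem_nhds haT, ?_⟩
    let g : E' → ℝ := fun y ↦ f (T.symm (0, y))
    let U' : Set E' := {y | ((0 : ℝ), y) ∈ T.target}
    have hU' : IsOpen U' := T.open_target.preimage (by fun_prop)
    have hsymm : ContDiffOn ℝ ∞ (fun y : E' ↦ T.symm ((0 : ℝ), y)) U' :=
      hTs.comp (by fun_prop) fun y hy ↦ hy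
    have hg : ContDiffOn ℝ ∞ g U' := hf.comp hsymm fun y hy ↦ hTU (T.map_target hy)
    refine measure_mono_null ?_ (ih hU' hg (by omega))
    rintro _ ⟨x, ⟨⟨hxU, hx0, hxi, -⟩, hxT⟩, rfl⟩
    have hTx : T x = (0, (T x).2) := Prod.ext (by rw [hT1, hxi]; rfl) rfl
    have hxs : T.symm (0, (T x).2) = x := by rw [← hTx, T.left_inv hxT]
    have hmem : (T x).2 ∈ U' := by
      change ((0 : ℝ), (T x).2) ∈ T.target
      rw [← hTx]
      exact T.map_source hxT
    refine ⟨(T x).2, ⟨hmem, ?_⟩, congrArg f hxs⟩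
    have hd := (hsymm.contDiffAt (hU'.mem_nhds hmem)).differentiableAt (by simp)
    have hfd : DifferentiableAt ℝ f (T.symm (0, (T x).2)) := by
      rw [hxs]
      exact (hat x hxU).differentiableAt (by simp)
    have := fderiv_comp (T x).2 hfd hd
    rw [hxs, hx0, ContinuousLinearMap.zero_comp] at this
    exact this

end SardReal

/-! ### Sard's theorem for maps into `ℝᵖ`. -/

/-- **Sard's theorem**: the set of critical values of a smooth map into `ℝᵖ` is null. -/
theorem volume_image_not_surjective_fderiv_eq_zero {E : Type*} [NormedAddCommGroup E]
    [NormedSpace ℝ E] [FiniteDimensional ℝ E] {p : ℕ} {f : E → Fin p → ℝ} {U : Set E}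
    (hU : IsOpen U) (hf : ContDiffOn ℝ ∞ f U) :
    volume (f '' {x ∈ U | ¬ Function.Surjective (fderiv ℝ f x)}) = 0 := by
  induction p generalizing E with
  | zero =>
    have : {x ∈ U | ¬ Function.Surjective (fderiv ℝ f x)} = ∅ :=
      Set.eq_empty_of_forall_notMem fun x hx ↦ hx.2 fun y ↦ ⟨0, Subsingleton.elim _ _⟩
    simp [this]
  | succ p ih =>
    have hat : ∀ y ∈ U, ContDiffAt ℝ ∞ f y := fun y hy ↦ hf.contDiffAt (hU.mem_nhds hy)
    have hdiff : ∀ y ∈ U, DifferentiableAt ℝ f y := fun y hy ↦ (hat y hy).differentiableAt (by simp)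
    have hcover : {x ∈ U | ¬ Function.Surjective (fderiv ℝ f x)} ⊆
        {x ∈ U | fderiv ℝ (fun x ↦ f x 0) x = 0} ∪
        {x ∈ U | ¬ Function.Surjective (fderiv ℝ f x) ∧ ∃ i, fderiv ℝ (fun x ↦ f x i) x ≠ 0} := by
      intro x hx
      by_cases h : fderiv ℝ (fun x ↦ f x 0) x = 0
      · exact Or.inl ⟨hx.1, h⟩
      · exact Or.inr ⟨hx.1, hx.2, 0, h⟩
    refine measure_mono_null (Set.image_mono hcover) ?_
    rw [Set.image_union]
    refine measure_union_null ?_ ?_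
    -- These values lie in the cylinder over the critical values of the component `0`.
    · have h0 := volume_image_fderiv_eq_zero hU (f := fun x ↦ f x 0) (contDiffOn_pi.1 hf 0)
      have hq := Measure.quasiMeasurePreserving_eval (fun _ : Fin (p + 1) ↦ (volume : Measure ℝ)) 0
      refine measure_mono_null ?_ (hq.preimage_null h0)
      rintro _ ⟨x, hx, rfl⟩
      exact ⟨x, hx, rfl⟩
    refine measure_image_null_of_locally_null fun a ha ↦ ?_
    obtain ⟨haU, -, i, hi⟩ := ha
    obtain ⟨E', -, T, haT, hTU, hT1, hTs⟩ :=
      (contDiffOn_pi.1 hf i).exists_chart_fst_eq hU haU hi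
    -- Compactness serves measurability: the critical points in `K` form a compact set, so their
    -- image is closed and Fubini applies to it.
    obtain ⟨K, haK, hKT, hK⟩ := local_compact_nhds (T.open_source.mem_nhds haT)
    refine ⟨K, haK, ?_⟩
    set A := {x ∈ K | ¬ Function.Surjective (fderiv ℝ f x)}
    refine measure_mono_null (Set.image_mono (t := A) fun x hx ↦ ⟨hx.2, hx.1.2.1⟩) ?_
    have hKU : K ⊆ U := hKT.trans hTU
    have hA : IsCompact A := by
      have hc : ContinuousOn (fderiv ℝ f) K :=
        (hf.continuousOn_fderiv_of_isOpen hU (by simp)).mono hKU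
      have := hc.preimage_isClosed_of_isClosed hK.isClosed
        (ContinuousLinearMap.isOpen_setOf_surjective_of_finiteDimensional E
          (Fin (p + 1) → ℝ)).isClosed_compl
      exact hK.of_isClosed_subset this fun x hx ↦ hx.1
    have hfA : IsCompact (f '' A) := hA.image_of_continuousOn (hf.continuousOn.mono fun x hx ↦ hKU hx.1)
    have hmp := (volume_preserving_piFinSuccAbove (fun _ : Fin (p + 1) ↦ ℝ) i).symm
    rw [← hmp.measure_preimage_equiv]
    have hmeas := (MeasurableEquiv.piFinSuccAbove (fun _ : Fin (p + 1) ↦ ℝ) i).symm.measurable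
      hfA.isClosed.measurableSet
    refine (Measure.measure_prod_null hmeas).2 (Filter.Eventually.of_forall fun u ↦ ?_)
    let U' : Set E' := {y | (u, y) ∈ T.target}
    let D' : (Fin (p + 1) → ℝ) →L[ℝ] (Fin p → ℝ) := ContinuousLinearMap.pi fun j ↦
      ContinuousLinearMap.proj (i.succAbove j)
    -- In the chart `T` the component `i` is the first coordinate, so the slice of the image at
    -- height `u` consists of values of the other components on `{u} × E'`.
    let g : E' → Fin p → ℝ := fun y ↦ D' (f (T.symm (u, y)))
    have hU' : IsOpen U' := T.open_target.preimage (by fun_prop)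
    have hfT : ContDiffOn ℝ ∞ (f ∘ T.symm) T.target :=
      hf.comp hTs fun y hy ↦ hTU (T.map_target hy)
    have hg : ContDiffOn ℝ ∞ g U' := by
      have h1 : ContDiffOn ℝ ∞ (fun y : E' ↦ f (T.symm (u, y))) U' :=
        hfT.comp (t := T.target) (by fun_prop) fun y hy ↦ hy
      exact D'.contDiff.comp_contDiffOn h1
    refine measure_mono_null ?_ (ih hU' hg)
    rintro c ⟨x, ⟨hxK, hxs⟩, hxc⟩
    replace hxc : f x = i.insertNth (α := fun _ ↦ ℝ) u c := hxc
    have hxi : f x i = u := by simp [hxc]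
    have hTx : T x = (u, (T x).2) := Prod.ext (by rw [hT1, hxi]) rfl
    have hsx : T.symm (u, (T x).2) = x := by rw [← hTx, T.left_inv (hKT hxK)]
    have hmem : (u, (T x).2) ∈ T.target := hTx ▸ T.map_source (hKT hxK)
    refine ⟨(T x).2, ⟨hmem, fun hsurj ↦ hxs ?_⟩, ?_⟩
    swap
    · change D' (f (T.symm (u, (T x).2))) = c
      rw [hsx, hxc]
      ext j
      simp [D']
    have hTd : HasFDerivAt T.symm (fderiv ℝ T.symm (u, (T x).2)) (u, (T x).2) :=
      ((hTs.contDiffAt (T.open_target.mem_nhds hmem)).differentiableAt (by simp)).hasFDerivAt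
    have hQ : HasFDerivAt (f ∘ T.symm)
        ((fderiv ℝ f x).comp (fderiv ℝ T.symm (u, (T x).2))) (u, (T x).2) :=
      HasFDerivAt.comp _ (by rw [hsx]; exact (hdiff x (hKU hxK)).hasFDerivAt) hTd
    set Q := (fderiv ℝ f x).comp (fderiv ℝ T.symm (u, (T x).2)) with hQdef
    have hQi : ∀ z, Q z i = z.1 := by
      have h1 := (ContinuousLinearMap.proj (R := ℝ) (φ := fun _ : Fin (p + 1) ↦ ℝ)
        i).hasFDerivAt.comp _ hQ
      have h2 : HasFDerivAt (fun z : ℝ × E' ↦ f (T.symm z) i)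
          (ContinuousLinearMap.fst ℝ ℝ E') (u, (T x).2) := by
        refine hasFDerivAt_fst.congr_of_eventuallyEq ?_
        filter_upwards [T.open_target.mem_nhds hmem] with z hz
        rw [← hT1, T.right_inv hz]
      exact fun z ↦ DFunLike.congr_fun (h1.unique h2) z
    have hQg : ∀ b, fderiv ℝ g (T x).2 b = D' (Q (0, b)) := by
      have h1 : HasFDerivAt g (D'.comp (Q.comp (ContinuousLinearMap.inr ℝ ℝ E'))) (T x).2 :=
        D'.hasFDerivAt.comp _ (hQ.comp (T x).2 (hasFDerivAt_prodMk_right u (T x).2))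
      intro b
      rw [h1.fderiv]
      rfl
    intro z
    -- `Q` is block triangular, with row `i` equal to the first projection: the first coordinate `z
    -- i` settles component `i`, and `b` then corrects the others. Hence a critical point of `f` is
    -- critical for `g`.
    obtain ⟨b, hb⟩ := hsurj (D' (z - Q (z i, 0)))
    refine ⟨fderiv ℝ T.symm (u, (T x).2) (z i, b), ?_⟩
    have hsum : Q (z i, b) = Q (z i, 0) + Q (0, b) := by rw [← map_add]; simp
    change Q (z i, b) = z
    ext l
    refine Fin.succAboveCases i ?_ (fun j ↦ ?_) l
    · exact hQi _
    · rw [hQg, map_sub, eq_sub_iff_add_eq, add_comm, ← map_add, ← hsum] at hb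
      exact congrFun hb j

/-! ### Derivatives read in charts, and Sard's theorem on manifolds. -/

section ChartCalculus

variable {E : Type*} [NormedAddCommGroup E] [NormedSpace ℝ E] {M : Type*} [TopologicalSpace M]
  [ChartedSpace E M] {G : Type*} [NormedAddCommGroup G] [NormedSpace ℝ G]
  {e : OpenPartialHomeomorph M E}

theorem OpenPartialHomeomorph.mdifferentiable_of_mem_smooth_maximalAtlas
    (he : e ∈ IsManifold.maximalAtlas 𝓘(ℝ, E) ∞ M) : e.MDifferentiable 𝓘(ℝ, E) 𝓘(ℝ, E) :=
  ⟨(contMDiffOn_of_mem_maximalAtlas he).mdifferentiableOn (by simp),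
    (contMDiffOn_symm_of_mem_maximalAtlas he).mdifferentiableOn (by simp)⟩

/-- A smooth function on an open set, read in a chart, is smooth. -/
theorem ContMDiffOn.contDiffOn_comp_chart_symm (he : e ∈ IsManifold.maximalAtlas 𝓘(ℝ, E) ∞ M)
    {F : M → G} {U : Set M} (hF : ContMDiffOn 𝓘(ℝ, E) 𝓘(ℝ, G) ∞ F U) :
    ContDiffOn ℝ ∞ (F ∘ e.symm) (e.target ∩ e.symm ⁻¹' U) :=
  contMDiffOn_iff_contDiffOn.1 (hF.comp ((contMDiffOn_symm_of_mem_maximalAtlas he).mono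
    Set.inter_subset_left) Set.inter_subset_right)

theorem ContMDiff.contDiffOn_comp_chart_symm (he : e ∈ IsManifold.maximalAtlas 𝓘(ℝ, E) ∞ M)
    {F : M → G} (hF : ContMDiff 𝓘(ℝ, E) 𝓘(ℝ, G) ∞ F) : ContDiffOn ℝ ∞ (F ∘ e.symm) e.target := by
  simpa using (hF.contMDiffOn (s := Set.univ)).contDiffOn_comp_chart_symm he

/-- The derivative of a function on a manifold in terms of its expression in a chart. -/
theorem mfderiv_apply_eq_fderiv_comp_chart_symm (he : e ∈ IsManifold.maximalAtlas 𝓘(ℝ, E) ∞ M)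
    {x : M} (hx : x ∈ e.source) {F : M → G} (hF : MDifferentiableAt 𝓘(ℝ, E) 𝓘(ℝ, G) F x)
    (v : TangentSpace 𝓘(ℝ, E) x) :
    mfderiv 𝓘(ℝ, E) 𝓘(ℝ, G) F x v =
      fderiv ℝ (F ∘ e.symm) (e x) (mfderiv 𝓘(ℝ, E) 𝓘(ℝ, E) e x v) := by
  have hm := e.mdifferentiable_of_mem_smooth_maximalAtlas he
  have h1 : F =ᶠ[𝓝 x] (F ∘ e.symm) ∘ e := by
    filter_upwards [e.open_source.mem_nhds hx] with y hy
    simp [e.left_inv hy]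
  have h2 : MDifferentiableAt 𝓘(ℝ, E) 𝓘(ℝ, G) (F ∘ e.symm) (e x) :=
    MDifferentiableAt.comp (I' := 𝓘(ℝ, E)) (e x) (by rwa [e.left_inv hx])
      (hm.mdifferentiableAt_symm (e.map_source hx))
  rw [h1.mfderiv_eq, mfderiv_comp (I' := 𝓘(ℝ, E)) x h2 (hm.mdifferentiableAt hx),
    mfderiv_eq_fderiv]
  rfl

theorem mfderiv_surjective_iff_fderiv_comp_chart_symm
    (he : e ∈ IsManifold.maximalAtlas 𝓘(ℝ, E) ∞ M) {x : M} (hx : x ∈ e.source) {F : M → G}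
    (hF : MDifferentiableAt 𝓘(ℝ, E) 𝓘(ℝ, G) F x) :
    Function.Surjective (mfderiv 𝓘(ℝ, E) 𝓘(ℝ, G) F x) ↔
      Function.Surjective (fderiv ℝ (F ∘ e.symm) (e x)) := by
  have hb := (e.mdifferentiable_of_mem_smooth_maximalAtlas he).mfderiv_bijective hx
  have : (mfderiv 𝓘(ℝ, E) 𝓘(ℝ, G) F x : TangentSpace 𝓘(ℝ, E) x → G) =
      fderiv ℝ (F ∘ e.symm) (e x) ∘ mfderiv 𝓘(ℝ, E) 𝓘(ℝ, E) e x :=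
    funext fun v ↦ mfderiv_apply_eq_fderiv_comp_chart_symm he hx hF v
  exact (Iff.of_eq (congrArg Function.Surjective this)).trans (hb.surjective.of_comp_iff _)

/-- **Sard's theorem** on a second countable manifold. -/
theorem volume_image_not_surjective_mfderiv_eq_zero [FiniteDimensional ℝ E]
    [SecondCountableTopology M] [IsManifold 𝓘(ℝ, E) ∞ M] {r : ℕ} {F : M → Fin r → ℝ} {U : Set M}
    (hU : IsOpen U) (hF : ContMDiffOn 𝓘(ℝ, E) 𝓘(ℝ, Fin r → ℝ) ∞ F U) :
    volume (F '' {x ∈ U | ¬ Function.Surjective (mfderiv 𝓘(ℝ, E) 𝓘(ℝ, Fin r → ℝ) F x)}) = 0 := by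
  refine measure_image_null_of_locally_null fun a _ ↦
    ⟨(chartAt E a).source, chart_source_mem_nhds E a, ?_⟩
  have he := IsManifold.chart_mem_maximalAtlas (I := 𝓘(ℝ, E)) (n := ∞) a
  set e := chartAt E a
  refine measure_mono_null ?_ (volume_image_not_surjective_fderiv_eq_zero
    (e.symm.isOpen_inter_preimage hU) (hF.contDiffOn_comp_chart_symm he))
  rintro _ ⟨x, ⟨⟨hxU, hxs⟩, hxe⟩, rfl⟩
  have hxe' : e.symm (e x) = x := e.left_inv hxe
  refine ⟨e x, ⟨⟨e.map_source hxe, by simpa [hxe'] using hxU⟩, ?_⟩, by simp [hxe']⟩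
  rwa [← mfderiv_surjective_iff_fderiv_comp_chart_symm he hxe
    ((hF.contMDiffAt (hU.mem_nhds hxU)).mdifferentiableAt (by simp))]

end ChartCalculus

/-! ### Regular level sets are submanifolds. -/

namespace ConstrainedHamiltonian

variable {n : ℕ} {M : Type*} [TopologicalSpace M]
  [ChartedSpace (EuclideanSpace ℝ (Fin (2 * n))) M]

/-- Being a submanifold is a local property. -/
theorem isSmoothSubmanifold_of_locally {d : ℕ} {S : Set M}
    (h : ∀ x ∈ S, ∃ U, IsOpen U ∧ x ∈ U ∧ IsSmoothSubmanifold (n := n) d (S ∩ U)) :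
    IsSmoothSubmanifold (n := n) d S := by
  intro x hx
  obtain ⟨U, hU, hxU, hS⟩ := h x hx
  obtain ⟨e, he, hxe, hiff⟩ := hS x ⟨hx, hxU⟩
  refine ⟨e.restr U, restr_mem_maximalAtlas _ he hU, ?_, fun y hy ↦ ?_⟩
  · simpa [hU.interior_eq] using ⟨hxe, hxU⟩
  · rw [e.restr_source, hU.interior_eq] at hy
    simpa [hy.2] using hiff y hy.1

variable [IsManifold (𝓡 (2 * n)) ∞ M]

theorem ae_isRegularValueOn [SecondCountableTopology M] {r : ℕ} {F : M → Fin r → ℝ} {U : Set M}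
    (hU : IsOpen U) (hF : ContMDiffOn (𝓡 (2 * n)) 𝓘(ℝ, Fin r → ℝ) ∞ F U) :
    ∀ᵐ c : Fin r → ℝ, IsRegularValueOn (n := n) F U c := by
  refine measure_mono_null (fun c hc ↦ ?_) (volume_image_not_surjective_mfderiv_eq_zero hU hF)
  simp only [IsRegularValueOn, Set.mem_compl_iff, Set.mem_ofPred_eq] at hc
  push Not at hc
  obtain ⟨x, hx, hxc, hs⟩ := hc
  exact ⟨x, ⟨hx, hs⟩, hxc⟩

/-- A linear surjection onto `ℝʳ` is given by the last coordinates in suitable linear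
coordinates. -/
theorem exists_equiv_last_coords_eq {m d r : ℕ} (hm : d + r = m)
    (T : EuclideanSpace ℝ (Fin m) →L[ℝ] (Fin r → ℝ)) (hT : Function.Surjective T) :
    ∃ A : EuclideanSpace ℝ (Fin m) ≃L[ℝ] EuclideanSpace ℝ (Fin m),
      ∀ v (j : Fin r), A v ⟨d + j, by omega⟩ = T v j := by
  subst hm
  obtain ⟨R, hR⟩ := (T : EuclideanSpace ℝ (Fin (d + r)) →ₗ[ℝ] Fin r → ℝ).exists_rightInverse_of_surjective
    (LinearMap.range_eq_top.2 hT)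
  let B := ContinuousLinearEquiv.equivOfRightInverse T (LinearMap.toContinuousLinearMap R)
    (LinearMap.congr_fun hR)
  have hd : finrank ℝ T.ker = finrank ℝ (Fin d → ℝ) := by
    have h := B.toLinearEquiv.finrank_eq
    simp only [finrank_prod, finrank_euclideanSpace, Fintype.card_fin, finrank_pi] at h
    simp
    omega
  let C : T.ker ≃ₗ[ℝ] (Fin d → ℝ) := LinearEquiv.ofFinrankEq _ _ hd
  let D : EuclideanSpace ℝ (Fin (d + r)) →ₗ[ℝ] EuclideanSpace ℝ (Fin (d + r)) :=
    (WithLp.linearEquiv 2 ℝ (Fin (d + r) → ℝ)).symm.toLinearMap ∘ₗ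
      LinearMap.pi (Fin.addCases (fun j ↦ LinearMap.proj j ∘ₗ C.toLinearMap ∘ₗ
        LinearMap.snd ℝ (Fin r → ℝ) T.ker ∘ₗ B.toLinearEquiv.toLinearMap)
        (fun j ↦ LinearMap.proj j ∘ₗ T.toLinearMap))
  have hD1 : ∀ v j, D v (Fin.castAdd r j) = C (B v).2 j := fun v j ↦ by simp [D]
  have hD2 : ∀ v j, D v (Fin.natAdd d j) = T v j := fun v j ↦ by simp [D]
  have hinj : Function.Injective D := by
    refine (injective_iff_map_eq_zero D).2 fun v hv ↦ ?_
    have h1 : C (B v).2 = 0 := by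
      ext j
      rw [← hD1, hv]
      rfl
    have h2 : (B v).1 = 0 := by
      ext j
      change T v j = 0
      rw [← hD2, hv]
      rfl
    have h3 : B v = 0 := Prod.ext h2 (by simpa using h1)
    simpa using h3
  exact ⟨(LinearEquiv.ofInjectiveEndo D hinj).toContinuousLinearEquiv, fun v j ↦ hD2 v j⟩

/-- Composing a chart of the smooth structure with a smooth partial homeomorphism with smooth
inverse gives a chart of the smooth structure. -/
theorem trans_mem_maximalAtlas {E : Type*} [NormedAddCommGroup E] [NormedSpace ℝ E] {M : Type*}
    [TopologicalSpace M] [ChartedSpace E M]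
    {e : OpenPartialHomeomorph M E} (he : e ∈ IsManifold.maximalAtlas 𝓘(ℝ, E) ∞ M)
    {T : OpenPartialHomeomorph E E} (hT : ContDiffOn ℝ ∞ T T.source)
    (hT' : ContDiffOn ℝ ∞ T.symm T.target) :
    e.trans T ∈ IsManifold.maximalAtlas 𝓘(ℝ, E) ∞ M := by
  have hG : T ∈ contDiffGroupoid ∞ 𝓘(ℝ, E) := by
    refine mem_groupoid_of_pregroupoid.2 ⟨?_, ?_⟩
    · simpa [contDiffPregroupoid] using hT
    · simpa [contDiffPregroupoid] using hT'
  refine (mem_maximalAtlas_iff).2 fun e' he' ↦ ?_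
  have h := mem_maximalAtlas_iff.1 he e' he'
  refine ⟨?_, ?_⟩
  · rw [OpenPartialHomeomorph.trans_symm_eq_symm_trans_symm, OpenPartialHomeomorph.trans_assoc]
    exact (contDiffGroupoid ∞ 𝓘(ℝ, E)).trans ((contDiffGroupoid ∞ 𝓘(ℝ, E)).symm hG) h.1
  · rw [← OpenPartialHomeomorph.trans_assoc]
    exact (contDiffGroupoid ∞ 𝓘(ℝ, E)).trans h.2 hG

/-- **Regular level sets** are embedded submanifolds. -/
theorem isSmoothSubmanifold_of_isRegularValueOn {d r : ℕ} (hd : d + r = 2 * n)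
    {F : M → Fin r → ℝ} {U : Set M} (hU : IsOpen U)
    (hF : ContMDiffOn (𝓡 (2 * n)) 𝓘(ℝ, Fin r → ℝ) ∞ F U) {c : Fin r → ℝ}
    (hc : IsRegularValueOn (n := n) F U c) :
    IsSmoothSubmanifold (n := n) d {x ∈ U | F x = c} := by
  rintro a ⟨haU, hac⟩
  have he := IsManifold.chart_mem_maximalAtlas (I := 𝓡 (2 * n)) (n := ∞) a
  have hae : a ∈ (chartAt (EuclideanSpace ℝ (Fin (2 * n))) a).source := mem_chart_source _ a
  set e := chartAt (EuclideanSpace ℝ (Fin (2 * n))) a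
  have hsurj := (mfderiv_surjective_iff_fderiv_comp_chart_symm he hae
    ((hF.contMDiffAt (hU.mem_nhds haU)).mdifferentiableAt (by simp))).1 (hc a haU hac)
  have hO : IsOpen (e.target ∩ e.symm ⁻¹' U) := e.symm.isOpen_inter_preimage hU
  have hf := hF.contDiffOn_comp_chart_symm he
  have haO : e a ∈ e.target ∩ e.symm ⁻¹' U :=
    ⟨e.map_source hae, by simpa [e.left_inv hae] using haU⟩
  set f := F ∘ e.symm
  obtain ⟨A, hA⟩ := exists_equiv_last_coords_eq hd (fderiv ℝ f (e a)) hsurj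
  -- The linear coordinates `A`, with the last `r` replaced by the components of `f - c`. The choice
  -- of `A` makes the derivative at `e a` equal to `A`, hence invertible.
  let coord : Fin (2 * n) → EuclideanSpace ℝ (Fin (2 * n)) → ℝ := fun j z ↦
    if h : d ≤ (j : ℕ) then f z ⟨j - d, by omega⟩ - c ⟨j - d, by omega⟩ else A z j
  have hcoord : ∀ j, ContDiffOn ℝ ∞ (coord j) (e.target ∩ e.symm ⁻¹' U) := by
    intro j
    by_cases h : d ≤ (j : ℕ)
    · simp only [coord, h, dif_pos]
      exact (contDiffOn_pi.1 hf _).sub contDiffOn_const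
    · simp only [coord, h, dif_neg, not_false_iff]
      exact ((EuclideanSpace.proj (𝕜 := ℝ) j).contDiff.comp A.contDiff).contDiffOn
  have hfd : HasFDerivAt f (fderiv ℝ f (e a)) (e a) :=
    ((hf.contDiffAt (hO.mem_nhds haO)).differentiableAt (by simp)).hasFDerivAt
  have hcoordd : ∀ j, HasFDerivAt (coord j) ((EuclideanSpace.proj (𝕜 := ℝ) j).comp
      (A : EuclideanSpace ℝ (Fin (2 * n)) →L[ℝ] EuclideanSpace ℝ (Fin (2 * n)))) (e a) := by
    intro j
    by_cases h : d ≤ (j : ℕ)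
    · simp only [coord, h, dif_pos]
      refine ((hasFDerivAt_pi'.1 hfd ⟨j - d, by omega⟩).sub_const _).congr_fderiv ?_
      ext v
      have := hA v ⟨j - d, by omega⟩
      simp only [Nat.add_sub_cancel' h] at this
      exact this.symm
    · simp only [coord, h, dif_neg, not_false_iff]
      exact ((EuclideanSpace.proj (𝕜 := ℝ) j).comp (A : EuclideanSpace ℝ (Fin (2 * n)) →L[ℝ]
        EuclideanSpace ℝ (Fin (2 * n)))).hasFDerivAt
  let Φ : EuclideanSpace ℝ (Fin (2 * n)) → EuclideanSpace ℝ (Fin (2 * n)) :=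
    fun z ↦ WithLp.toLp 2 fun j ↦ coord j z
  have hΦ : ContDiffOn ℝ ∞ Φ (e.target ∩ e.symm ⁻¹' U) := contDiffOn_euclidean.2 hcoord
  have hΦd : HasFDerivAt Φ (A : EuclideanSpace ℝ (Fin (2 * n)) →L[ℝ] _) (e a) :=
    hasFDerivWithinAt_univ.1 (hasFDerivWithinAt_euclidean.2 fun j ↦ (hcoordd j).hasFDerivWithinAt)
  obtain ⟨T, haT, hTO, hTΦ, hTs⟩ := hΦ.exists_openPartialHomeomorph hO haO A hΦd
  refine ⟨e.trans T, trans_mem_maximalAtlas he (hTΦ ▸ hΦ.mono hTO) hTs, ⟨hae, haT⟩, ?_⟩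
  rintro y ⟨hye, hyT⟩
  have hyU : y ∈ U := by simpa [e.left_inv hye] using (hTO hyT).2
  have hval : ∀ (j : Fin (2 * n)) (hj : d ≤ (j : ℕ)), (e.trans T) y j =
      F y ⟨j - d, by omega⟩ - c ⟨j - d, by omega⟩ := by
    intro j hj
    simp only [OpenPartialHomeomorph.coe_trans, Function.comp_apply, hTΦ, Φ, coord, hj, dif_pos, f,
      e.left_inv hye]
  constructor
  · rintro ⟨-, hy⟩ j hj
    rw [hval j hj, hy, sub_self]
  · refine fun h ↦ ⟨hyU, funext fun i ↦ ?_⟩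
    have := h ⟨d + i, by omega⟩ (by simp)
    rw [hval _ (by simp), sub_eq_zero] at this
    simpa using this

end ConstrainedHamiltonian

/-! ### The pairing of a function with a frame, and its frame-independent normalization. -/

namespace ConstrainedHamiltonian

section Pairing

variable {E : Type*} [NormedAddCommGroup E] [NormedSpace ℝ E] {r : ℕ}

/-- The derivatives of `h` along the vector fields `y i`. -/
noncomputable def pairing (h : E → ℝ) (y : Fin r → E → E) (z : E) : Fin r → ℝ := fun i ↦ fderiv ℝ h z (y i z)

/-- The matrix `(L (y i z))_j` as a continuous linear map. -/
noncomputable def frameMatrix (L : E →L[ℝ] (Fin r → ℝ)) (y : Fin r → E → E) (z : E) :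
    (Fin r → ℝ) →L[ℝ] (Fin r → ℝ) :=
  ContinuousLinearMap.pi fun i ↦ ∑ j, L (y i z) j • ContinuousLinearMap.proj j

/-- The derivatives of `h` along the frame dual to `L` of the span of the vector fields `y i`. -/
noncomputable def normalizedPairing (L : E →L[ℝ] (Fin r → ℝ)) (h : E → ℝ) (y : Fin r → E → E) (z : E) :
    Fin r → ℝ := (frameMatrix L y z).inverse (pairing h y z)

variable {L : E →L[ℝ] (Fin r → ℝ)} {h : E → ℝ} {y y' : Fin r → E → E} {z : E}

theorem frameMatrix_apply (c : Fin r → ℝ) (i : Fin r) :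
    frameMatrix L y z c i = ∑ j, L (y i z) j * c j := by
  simp [frameMatrix]

theorem frameMatrix_isInvertible_iff :
    (frameMatrix L y z).IsInvertible ↔ LinearIndependent ℝ fun i ↦ L (y i z) := by
  have hA : ∀ c, frameMatrix L y z c = (Matrix.of fun i j ↦ L (y i z) j).mulVec c := fun c ↦ by
    ext i
    rw [frameMatrix_apply]
    rfl
  have hrow : (Matrix.of fun i j ↦ L (y i z) j).row = fun i ↦ L (y i z) := rfl
  rw [← hrow, Matrix.linearIndependent_rows_iff_isUnit, ← Matrix.mulVec_injective_iff_isUnit,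
    ← show (frameMatrix L y z : (Fin r → ℝ) → Fin r → ℝ) = _ from funext hA]
  refine ⟨fun hi ↦ hi.injective, fun hi ↦ ?_⟩
  exact ⟨(LinearEquiv.ofInjectiveEndo (frameMatrix L y z).toLinearMap hi).toContinuousLinearEquiv,
    by ext; rfl⟩

theorem frameMatrix_isInvertible_of_disjoint (hy : LinearIndependent ℝ fun i ↦ y i z)
    (hL : Disjoint (Submodule.span ℝ (Set.range fun i ↦ y i z)) L.ker) :
    (frameMatrix L y z).IsInvertible :=
  frameMatrix_isInvertible_iff.2 (hy.map (f := L.toLinearMap) hL)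

theorem disjoint_of_frameMatrix_isInvertible (hM : (frameMatrix L y z).IsInvertible) :
    Disjoint (Submodule.span ℝ (Set.range fun i ↦ y i z)) L.ker := by
  refine Submodule.disjoint_def.2 fun v hv hLv ↦ ?_
  obtain ⟨c, rfl⟩ := (Submodule.mem_span_range_iff_exists_fun ℝ).1 hv
  have h0 : ∑ i, c i • L (y i z) = 0 := by
    rw [← hLv]
    simp
  have hc := Fintype.linearIndependent_iff.1 (frameMatrix_isInvertible_iff.1 hM) c h0
  simp [hc]

/-- The normalized pairing depends on the span of the vector fields only. -/
theorem normalizedPairing_eq (hM : (frameMatrix L y z).IsInvertible)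
    (hM' : (frameMatrix L y' z).IsInvertible)
    (hy : ∀ i, y' i z ∈ Submodule.span ℝ (Set.range fun i ↦ y i z)) :
    normalizedPairing L h y' z = normalizedPairing L h y z := by
  -- With `y' = a y`, both the frame matrix and the pairing are multiplied on the left by `a`, which
  -- therefore cancels.
  choose a ha using fun i ↦ (Submodule.mem_span_range_iff_exists_fun ℝ).1 (hy i)
  rw [normalizedPairing, hM'.inverse_apply_eq]
  have hp := hM.self_apply_inverse (pairing h y z)
  change frameMatrix L y z (normalizedPairing L h y z) = _ at hp
  ext i
  have h1 : pairing h y' z i = ∑ j, a i j * pairing h y z j := by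
    simp [pairing, ← ha i]
  rw [h1, ← hp, frameMatrix_apply]
  simp only [frameMatrix_apply, ← ha i, map_sum, map_smul, Finset.sum_apply, Pi.smul_apply,
    smul_eq_mul, Finset.sum_mul, Finset.mul_sum]
  rw [Finset.sum_comm]
  simp only [mul_assoc]

theorem pairing_eq_zero_iff (hM : (frameMatrix L y z).IsInvertible) :
    pairing h y z = 0 ↔ normalizedPairing L h y z = 0 := by
  rw [normalizedPairing, hM.inverse_apply_eq, map_zero]

variable {O : Set E}

theorem contDiffOn_pairing {m : WithTop ℕ∞} (hO : IsOpen O) (hh : ContDiffOn ℝ (m + 1) h O)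
    (hy : ∀ i, ContDiffOn ℝ m (y i) O) : ContDiffOn ℝ m (pairing h y) O :=
  contDiffOn_pi.2 fun i ↦ (hh.fderiv_of_isOpen hO le_rfl).clm_apply (hy i)

theorem contDiffOn_frameMatrix {m : WithTop ℕ∞} (hy : ∀ i, ContDiffOn ℝ m (y i) O) :
    ContDiffOn ℝ m (frameMatrix L y) O := by
  refine contDiffOn_clm_apply.2 fun c ↦ contDiffOn_pi.2 fun i ↦ ?_
  simp only [frameMatrix_apply]
  exact ContDiffOn.sum fun j _ ↦
    (contDiffOn_pi.1 (L.contDiff.comp_contDiffOn (hy i)) j).mul contDiffOn_const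

theorem isOpen_frameMatrix_isInvertible (hO : IsOpen O) (hy : ∀ i, ContDiffOn ℝ ∞ (y i) O) :
    IsOpen {z ∈ O | (frameMatrix L y z).IsInvertible} :=
  (contDiffOn_frameMatrix hy).continuousOn.isOpen_inter_preimage hO ContinuousLinearEquiv.isOpen

theorem contDiffAt_normalizedPairing (hO : IsOpen O) (hh : ContDiffOn ℝ ∞ h O)
    (hy : ∀ i, ContDiffOn ℝ ∞ (y i) O) (hz : z ∈ O) (hM : (frameMatrix L y z).IsInvertible) :
    ContDiffAt ℝ ∞ (normalizedPairing L h y) z := by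
  have h1 := (contDiffOn_pairing hO (m := ∞) hh hy).contDiffAt (hO.mem_nhds hz)
  have h2 := (contDiffOn_frameMatrix (L := L) hy).contDiffAt (hO.mem_nhds hz)
  exact (hM.contDiffAt_map_inverse.comp z h2).clm_apply h1

/-- Regularity of a zero of the pairing, in terms of the normalized pairing. -/
theorem fderiv_pairing_surjective_iff (hO : IsOpen O) (hh : ContDiffOn ℝ ∞ h O)
    (hy : ∀ i, ContDiffOn ℝ ∞ (y i) O) (hz : z ∈ O) (hM : (frameMatrix L y z).IsInvertible)
    (h0 : pairing h y z = 0) :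
    Function.Surjective (fderiv ℝ (pairing h y) z) ↔
      Function.Surjective (fderiv ℝ (normalizedPairing L h y) z) := by
  have hg := ((contDiffAt_normalizedPairing hO hh hy hz hM).differentiableAt (by simp)).hasFDerivAt
  have hd := (((contDiffOn_frameMatrix (L := L) hy).contDiffAt
    (hO.mem_nhds hz)).differentiableAt (by simp)).hasFDerivAt
  have hp : pairing h y =ᶠ[𝓝 z] fun u ↦ frameMatrix L y u (normalizedPairing L h y u) := by
    filter_upwards [(isOpen_frameMatrix_isInvertible (L := L) hO hy).mem_nhds ⟨hz, hM⟩] with u hu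
    exact (hu.2.self_apply_inverse _).symm
  -- In the product rule, the term differentiating the matrix drops out because the normalized
  -- pairing is zero at `z`.
  have hfd : fderiv ℝ (pairing h y) z =
      (frameMatrix L y z).comp (fderiv ℝ (normalizedPairing L h y) z) := by
    rw [((hd.clm_apply hg).congr_of_eventuallyEq hp).fderiv, (pairing_eq_zero_iff hM).1 h0]
    ext v
    simp
  obtain ⟨A, hA⟩ := hM
  rw [hfd, ← hA]
  exact EquivLike.comp_surjective _ A

/-- Adding a linear combination of the components of `L` translates the normalized pairing. -/
theorem normalizedPairing_add_linear (hM : (frameMatrix L y z).IsInvertible)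
    (hh : DifferentiableAt ℝ h z) (t : Fin r → ℝ) :
    normalizedPairing L (fun u ↦ h u + ∑ j, t j * L u j) y z = normalizedPairing L h y z + t := by
  have hl : HasFDerivAt (fun u ↦ ∑ j, t j * L u j)
      (∑ j, t j • (ContinuousLinearMap.proj (R := ℝ) (φ := fun _ : Fin r ↦ ℝ) j).comp L) z :=
    HasFDerivAt.fun_sum fun j _ ↦
      (((ContinuousLinearMap.proj (R := ℝ) (φ := fun _ : Fin r ↦ ℝ) j).comp L).hasFDerivAt.const_mul
        (t j))
  -- The pairing of the added linear function with `y` is the frame matrix applied to `t`.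
  rw [normalizedPairing, normalizedPairing, hM.inverse_apply_eq, map_add, hM.self_apply_inverse]
  ext i
  rw [Pi.add_apply, frameMatrix_apply, pairing, (hh.hasFDerivAt.fun_add hl).fderiv]
  simp [pairing, mul_comm]

/-- Linearly independent vectors have a dual system of linear forms. -/
theorem exists_frameMatrix_isInvertible (hy : LinearIndependent ℝ fun i ↦ y i z)
    [FiniteDimensional ℝ E] : ∃ L : E →L[ℝ] (Fin r → ℝ), (frameMatrix L y z).IsInvertible := by
  obtain ⟨T, hT⟩ := (Fintype.linearCombination ℝ (fun i ↦ y i z)).exists_leftInverse_of_injective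
    (LinearMap.ker_eq_bot.2 hy.fintypeLinearCombination_injective)
  refine ⟨LinearMap.toContinuousLinearMap T, frameMatrix_isInvertible_of_disjoint hy ?_⟩
  refine Submodule.disjoint_def.2 fun v hv hLv ↦ ?_
  obtain ⟨c, rfl⟩ := (Submodule.mem_span_range_iff_exists_fun ℝ).1 hv
  have h0 := LinearMap.congr_fun hT c
  rw [LinearMap.comp_apply, Fintype.linearCombination_apply] at h0
  have h1 : T (∑ i, c i • y i z) = 0 := hLv
  rw [h1] at h0
  simp [show c = 0 from h0.symm]

end Pairing

end ConstrainedHamiltonian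

/-! ### The critical set in a frame, and independence of regularity from the frame. -/

namespace ConstrainedHamiltonian

variable {n : ℕ} {M : Type*} [TopologicalSpace M]
  [ChartedSpace (EuclideanSpace ℝ (Fin (2 * n))) M]

section ChartFrame

variable {r : ℕ} {e : OpenPartialHomeomorph M (EuclideanSpace ℝ (Fin (2 * n)))}

/-- The expression of a family of vector fields in a chart. -/
noncomputable def chartFrame (e : OpenPartialHomeomorph M (EuclideanSpace ℝ (Fin (2 * n))))
    (Y : Fin r → (x : M) → TangentSpace (𝓡 (2 * n)) x) (i : Fin r)
    (z : EuclideanSpace ℝ (Fin (2 * n))) : EuclideanSpace ℝ (Fin (2 * n)) :=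
  mfderiv (𝓡 (2 * n)) (𝓡 (2 * n)) e (e.symm z) (Y i (e.symm z))

theorem frameMap_comp_chart_symm (he : e ∈ IsManifold.maximalAtlas (𝓡 (2 * n)) ∞ M)
    (Y : Fin r → (x : M) → TangentSpace (𝓡 (2 * n)) x) (H : C^∞⟮𝓡 (2 * n), M; 𝓘(ℝ, ℝ), ℝ⟯)
    {z : EuclideanSpace ℝ (Fin (2 * n))} (hz : z ∈ e.target) :
    frameMap Y H (e.symm z) = pairing (H ∘ e.symm) (chartFrame e Y) z := by
  ext i
  have := mfderiv_apply_eq_fderiv_comp_chart_symm he (e.map_target hz)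
    (H.contMDiff.mdifferentiableAt (by simp)) (Y i (e.symm z))
  rw [e.right_inv hz] at this
  exact this

end ChartFrame

variable [IsManifold (𝓡 (2 * n)) ∞ M]

section CriticalSet

variable {Ω : SymplecticForm n M} {k : ℕ} (V : SymplecticDistribution Ω k)
  (H : C^∞⟮𝓡 (2 * n), M; 𝓘(ℝ, ℝ), ℝ⟯)

theorem form_hamiltonianVectorField (x : M) (v : TangentSpace (𝓡 (2 * n)) x) :
    Ω.form x (hamiltonianVectorField Ω H x) v = -differential H x v := by
  rw [← Ω.bilin_apply]
  exact LinearMap.BilinForm.apply_toDual_symm_apply (hB := Ω.bilin_nondegenerate x)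
    (-differential H x) v

/-- The kernel of `π_V` is `V^⊥`, and pairing `X_H` with `v` under `Ω` gives `-dH(v)`. -/
theorem SymplecticDistribution.mem_criticalSet_iff (x : M) :
    x ∈ V.criticalSet H ↔ ∀ v ∈ V.fibre x, differential H x v = 0 := by
  change (V.fibre x).projection (V.perp x) (V.isCompl x) (hamiltonianVectorField Ω H x) = 0 ↔ _
  rw [Submodule.projection_apply_eq_zero_iff]
  refine forall₂_congr fun v _ ↦ ?_
  change Ω.bilin x v (hamiltonianVectorField Ω H x) = 0 ↔ _
  rw [← (Ω.bilin_isAlt x).neg_eq, neg_eq_zero, Ω.bilin_apply, form_hamiltonianVectorField,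
    neg_eq_zero]

theorem SymplecticDistribution.mem_criticalSet_iff_frameMap_eq_zero {U : Set M}
    {Y : Fin (2 * k) → (x : M) → TangentSpace (𝓡 (2 * n)) x} (hY : IsLocalFrame V.fibre U Y)
    {x : M} (hx : x ∈ U) : x ∈ V.criticalSet H ↔ frameMap Y H x = 0 := by
  rw [V.mem_criticalSet_iff, ← hY.span_eq x hx]
  constructor
  · exact fun h ↦ funext fun i ↦ h _ (Submodule.subset_span ⟨i, rfl⟩)
  · intro h v hv
    have : Submodule.span ℝ (Set.range fun i ↦ Y i x) ≤ LinearMap.ker (differential H x) := by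
      rw [Submodule.span_le]
      rintro _ ⟨i, rfl⟩
      exact congrFun h i
    exact this hv

theorem SymplecticDistribution.criticalSet_inter_eq {U : Set M}
    {Y : Fin (2 * k) → (x : M) → TangentSpace (𝓡 (2 * n)) x} (hY : IsLocalFrame V.fibre U Y) :
    V.criticalSet H ∩ U = {x ∈ U | frameMap Y H x = 0} := by
  ext x
  exact ⟨fun hx ↦ ⟨hx.2, (V.mem_criticalSet_iff_frameMap_eq_zero H hY hx.2).1 hx.1⟩,
    fun hx ↦ ⟨(V.mem_criticalSet_iff_frameMap_eq_zero H hY hx.1).2 hx.2, hx.1⟩⟩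

end CriticalSet

section Frames

variable {r : ℕ} {e : OpenPartialHomeomorph M (EuclideanSpace ℝ (Fin (2 * n)))}
  {Y : Fin r → (x : M) → TangentSpace (𝓡 (2 * n)) x} {U : Set M}
  {W : (x : M) → Submodule ℝ (TangentSpace (𝓡 (2 * n)) x)}

theorem IsLocalFrame.contDiffOn_chartFrame (hY : IsLocalFrame W U Y)
    (he : e ∈ IsManifold.maximalAtlas (𝓡 (2 * n)) ∞ M) (i : Fin r) :
    ContDiffOn ℝ ∞ (chartFrame e Y i) (e.target ∩ e.symm ⁻¹' U) := by
  have h1 := (contMDiffOn_of_mem_maximalAtlas he).contMDiffOn_tangentMapWithin (m := ∞)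
    (by simp) e.open_source.uniqueMDiffOn
  have h2 := h1.comp ((hY.smooth i).mono (Set.inter_subset_right (s := e.source)))
    (fun x hx ↦ hx.1)
  have h3 : ContMDiffOn (𝓡 (2 * n)) 𝓘(ℝ, EuclideanSpace ℝ (Fin (2 * n))) ∞
      (fun x ↦ (mfderivWithin (𝓡 (2 * n)) (𝓡 (2 * n)) e e.source x (Y i x) :
        EuclideanSpace ℝ (Fin (2 * n)))) (e.source ∩ U) := by
    intro x hx
    have h := (Bundle.contMDiffWithinAt_totalSpace.1 (h2 x hx)).2
    simpa [tangentMapWithin, TangentBundle.trivializationAt_apply] using h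
  have h4 := h3.contDiffOn_comp_chart_symm he
  refine (h4.mono fun z hz ↦ ⟨hz.1, e.map_target hz.1, hz.2⟩).congr fun z hz ↦ ?_
  have : mfderivWithin (𝓡 (2 * n)) (𝓡 (2 * n)) e e.source (e.symm z) =
      mfderiv (𝓡 (2 * n)) (𝓡 (2 * n)) e (e.symm z) :=
    mfderivWithin_of_isOpen e.open_source (e.map_target hz.1)
  exact congrFun (congrArg DFunLike.coe this.symm) (Y i (e.symm z))

theorem IsLocalFrame.linearIndependent_chartFrame (hY : IsLocalFrame W U Y)
    (he : e ∈ IsManifold.maximalAtlas (𝓡 (2 * n)) ∞ M) {z : EuclideanSpace ℝ (Fin (2 * n))}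
    (hz : z ∈ e.target ∩ e.symm ⁻¹' U) : LinearIndependent ℝ fun i ↦ chartFrame e Y i z := by
  have hb := (e.mdifferentiable_of_mem_smooth_maximalAtlas he).mfderiv_bijective
    (e.map_target hz.1)
  exact (hY.linearIndependent _ hz.2).map' (mfderiv (𝓡 (2 * n)) (𝓡 (2 * n)) e
    (e.symm z)).toLinearMap (LinearMap.ker_eq_bot.2 hb.injective)

theorem IsLocalFrame.chartFrame_mem_span {U' : Set M} (hY : IsLocalFrame W U Y)
    {Y' : Fin r → (x : M) → TangentSpace (𝓡 (2 * n)) x} (hY' : IsLocalFrame W U' Y')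
    {z : EuclideanSpace ℝ (Fin (2 * n))} (hz : e.symm z ∈ U) (hz' : e.symm z ∈ U') (i : Fin r) :
    chartFrame e Y' i z ∈ Submodule.span ℝ (Set.range fun i ↦ chartFrame e Y i z) := by
  have h1 : Y' i (e.symm z) ∈ Submodule.span ℝ (Set.range fun i ↦ Y i (e.symm z)) := by
    rw [hY.span_eq _ hz, ← hY'.span_eq _ hz']
    exact Submodule.subset_span ⟨i, rfl⟩
  have h2 := Submodule.mem_map_of_mem
    (f := (mfderiv (𝓡 (2 * n)) (𝓡 (2 * n)) e (e.symm z)).toLinearMap) h1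
  rw [Submodule.map_span, ← Set.range_comp] at h2
  exact h2

theorem IsLocalFrame.contDiffOn_pairing (hY : IsLocalFrame W U Y)
    (he : e ∈ IsManifold.maximalAtlas (𝓡 (2 * n)) ∞ M) (H : C^∞⟮𝓡 (2 * n), M; 𝓘(ℝ, ℝ), ℝ⟯) :
    ContDiffOn ℝ ∞ (pairing (H ∘ e.symm) (chartFrame e Y)) (e.target ∩ e.symm ⁻¹' U) :=
  ConstrainedHamiltonian.contDiffOn_pairing (e.symm.isOpen_inter_preimage hY.isOpen)
    ((H.contMDiff.contDiffOn_comp_chart_symm he).mono Set.inter_subset_left)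
    (hY.contDiffOn_chartFrame he)

theorem IsLocalFrame.contMDiffOn_frameMap (hY : IsLocalFrame W U Y)
    (H : C^∞⟮𝓡 (2 * n), M; 𝓘(ℝ, ℝ), ℝ⟯) :
    ContMDiffOn (𝓡 (2 * n)) 𝓘(ℝ, Fin r → ℝ) ∞ (frameMap Y H) U := by
  intro x hx
  have he := IsManifold.chart_mem_maximalAtlas (I := 𝓡 (2 * n)) (n := ∞) x
  have hxe : x ∈ (chartAt (EuclideanSpace ℝ (Fin (2 * n))) x).source := mem_chart_source _ x
  set e := chartAt (EuclideanSpace ℝ (Fin (2 * n))) x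
  have h1 : ContMDiffOn (𝓡 (2 * n)) 𝓘(ℝ, Fin r → ℝ) ∞
      (pairing (H ∘ e.symm) (chartFrame e Y) ∘ e) (e.source ∩ U) :=
    (contMDiffOn_iff_contDiffOn.2 (hY.contDiffOn_pairing he H)).comp
      ((contMDiffOn_of_mem_maximalAtlas he).mono Set.inter_subset_left)
      fun y hy ↦ ⟨e.map_source hy.1, by simpa [e.left_inv hy.1] using hy.2⟩
  have hnhds : e.source ∩ U ∈ 𝓝 x := (e.open_source.inter hY.isOpen).mem_nhds ⟨hxe, hx⟩
  refine ((h1.contMDiffAt hnhds).congr_of_eventuallyEq ?_).contMDiffWithinAt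
  filter_upwards [hnhds] with y hy
  rw [Function.comp_apply, ← frameMap_comp_chart_symm he Y H (e.map_source hy.1),
    e.left_inv hy.1]

/-- Surjectivity of the differential of the frame map in a chart. -/
theorem IsLocalFrame.mfderiv_frameMap_surjective_iff (hY : IsLocalFrame W U Y)
    (he : e ∈ IsManifold.maximalAtlas (𝓡 (2 * n)) ∞ M) (H : C^∞⟮𝓡 (2 * n), M; 𝓘(ℝ, ℝ), ℝ⟯)
    {x : M} (hx : x ∈ U) (hxe : x ∈ e.source) :
    Function.Surjective (mfderiv (𝓡 (2 * n)) 𝓘(ℝ, Fin r → ℝ) (frameMap Y H) x) ↔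
      Function.Surjective (fderiv ℝ (pairing (H ∘ e.symm) (chartFrame e Y)) (e x)) := by
  rw [mfderiv_surjective_iff_fderiv_comp_chart_symm he hxe
    (((hY.contMDiffOn_frameMap H).contMDiffAt (hY.isOpen.mem_nhds hx)).mdifferentiableAt (by simp))]
  have : frameMap Y H ∘ e.symm =ᶠ[𝓝 (e x)] pairing (H ∘ e.symm) (chartFrame e Y) := by
    filter_upwards [e.open_target.mem_nhds (e.map_source hxe)] with z hz
    exact frameMap_comp_chart_symm he Y H hz
  rw [this.fderiv_eq]

/-- The condition that `0` is a regular value, at a point of a chart, in terms of the normalized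
pairing. -/
theorem IsLocalFrame.regular_iff_normalizedPairing (hY : IsLocalFrame W U Y)
    (he : e ∈ IsManifold.maximalAtlas (𝓡 (2 * n)) ∞ M) (H : C^∞⟮𝓡 (2 * n), M; 𝓘(ℝ, ℝ), ℝ⟯)
    {L : EuclideanSpace ℝ (Fin (2 * n)) →L[ℝ] (Fin r → ℝ)}
    {x : M} (hx : x ∈ U) (hxe : x ∈ e.source)
    (hL : (frameMatrix L (chartFrame e Y) (e x)).IsInvertible) :
    (frameMap Y H x = 0 →
      Function.Surjective (mfderiv (𝓡 (2 * n)) 𝓘(ℝ, Fin r → ℝ) (frameMap Y H) x)) ↔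
    (normalizedPairing L (H ∘ e.symm) (chartFrame e Y) (e x) = 0 →
      Function.Surjective (fderiv ℝ (normalizedPairing L (H ∘ e.symm) (chartFrame e Y)) (e x))) := by
  have hfm : frameMap Y H x = pairing (H ∘ e.symm) (chartFrame e Y) (e x) := by
    rw [← frameMap_comp_chart_symm he Y H (e.map_source hxe), e.left_inv hxe]
  rw [← pairing_eq_zero_iff hL, ← hfm]
  refine forall_congr' fun h0 ↦ ?_
  rw [hY.mfderiv_frameMap_surjective_iff he H hx hxe]
  exact fderiv_pairing_surjective_iff (e.symm.isOpen_inter_preimage hY.isOpen)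
    ((H.contMDiff.contDiffOn_comp_chart_symm he).mono Set.inter_subset_left)
    (hY.contDiffOn_chartFrame he) ⟨e.map_source hxe, by simpa [e.left_inv hxe] using hx⟩ hL (hfm ▸ h0)

/-- Regularity of the zero value at a point does not depend on the frame. -/
theorem IsLocalFrame.regular_of_regular {U' : Set M} (hY : IsLocalFrame W U Y)
    {Y' : Fin r → (x : M) → TangentSpace (𝓡 (2 * n)) x} (hY' : IsLocalFrame W U' Y')
    (H : C^∞⟮𝓡 (2 * n), M; 𝓘(ℝ, ℝ), ℝ⟯) {x : M} (hx : x ∈ U) (hx' : x ∈ U')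
    (h : frameMap Y H x = 0 →
      Function.Surjective (mfderiv (𝓡 (2 * n)) 𝓘(ℝ, Fin r → ℝ) (frameMap Y H) x)) :
    frameMap Y' H x = 0 →
      Function.Surjective (mfderiv (𝓡 (2 * n)) 𝓘(ℝ, Fin r → ℝ) (frameMap Y' H) x) := by
  have he := IsManifold.chart_mem_maximalAtlas (I := 𝓡 (2 * n)) (n := ∞) x
  have hxe : x ∈ (chartAt (EuclideanSpace ℝ (Fin (2 * n))) x).source := mem_chart_source _ x
  set e := chartAt (EuclideanSpace ℝ (Fin (2 * n))) x
  have hz : e x ∈ e.target ∩ e.symm ⁻¹' U :=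
    ⟨e.map_source hxe, by simpa [e.left_inv hxe] using hx⟩
  have hz' : e x ∈ e.target ∩ e.symm ⁻¹' U' :=
    ⟨e.map_source hxe, by simpa [e.left_inv hxe] using hx'⟩
  obtain ⟨L, hL⟩ := exists_frameMatrix_isInvertible (hY.linearIndependent_chartFrame he hz)
  -- For a linearly independent family, invertibility means that its span meets the kernel of `L`
  -- trivially; this passes to `Y'`, whose span lies in that of `Y`.
  have hinv : ∀ z ∈ e.target ∩ e.symm ⁻¹' U, z ∈ e.target ∩ e.symm ⁻¹' U' →
      (frameMatrix L (chartFrame e Y) z).IsInvertible →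
      (frameMatrix L (chartFrame e Y') z).IsInvertible := fun z hz hz' hM ↦
    frameMatrix_isInvertible_of_disjoint (hY'.linearIndependent_chartFrame he hz')
      ((disjoint_of_frameMatrix_isInvertible hM).mono_left (Submodule.span_le.2 (by
        rintro _ ⟨i, rfl⟩
        exact hY.chartFrame_mem_span hY' hz.2 hz'.2 i)))
  have hO := e.symm.isOpen_inter_preimage hY.isOpen
  have heq : normalizedPairing L (H ∘ e.symm) (chartFrame e Y') =ᶠ[𝓝 (e x)]
      normalizedPairing L (H ∘ e.symm) (chartFrame e Y) := by
    filter_upwards [(isOpen_frameMatrix_isInvertible hO (hY.contDiffOn_chartFrame he)).mem_nhds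
      ⟨hz, hL⟩, (e.symm.isOpen_inter_preimage hY'.isOpen).mem_nhds hz'] with z h1 h2
    exact normalizedPairing_eq h1.2 (hinv z h1.1 h2 h1.2)
      fun i ↦ hY.chartFrame_mem_span hY' h1.1.2 h2.2 i
  rw [hY'.regular_iff_normalizedPairing he H hx' hxe (hinv _ hz hz' hL), heq.eq_of_nhds,
    heq.fderiv_eq]
  exact (hY.regular_iff_normalizedPairing he H hx hxe hL).1 h

end Frames

end ConstrainedHamiltonian

/-! ### Stability of regularity on compact sets under `C²`-small perturbations. -/

namespace ConstrainedHamiltonian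

section Pairing

variable {E : Type*} [NormedAddCommGroup E] [NormedSpace ℝ E] {r : ℕ}

theorem fderiv_pairing_apply {h : E → ℝ} {y : Fin r → E → E} {z : E} (hh : ContDiffAt ℝ 2 h z)
    (hy : ∀ i, DifferentiableAt ℝ (y i) z) (v : E) (i : Fin r) :
    fderiv ℝ (pairing h y) z v i =
      fderiv ℝ h z (fderiv ℝ (y i) z v) + fderiv ℝ (fderiv ℝ h) z v (y i z) := by
  have h1 : DifferentiableAt ℝ (fderiv ℝ h) z :=
    (hh.fderiv_right (m := 1) (by norm_num)).differentiableAt (by simp)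
  have h2 : HasFDerivAt (pairing h y) (ContinuousLinearMap.pi fun i ↦
      (fderiv ℝ h z).comp (fderiv ℝ (y i) z) + (fderiv ℝ (fderiv ℝ h) z).flip (y i z)) z :=
    hasFDerivAt_pi.2 fun i ↦ h1.hasFDerivAt.clm_apply (hy i).hasFDerivAt
  rw [h2.fderiv]
  simp

/-- Regularity of the zeros of the pairing on a compact set is stable under perturbations which are
small together with their derivatives of order at most two. -/
theorem exists_pos_regular_of_isCompact {O K : Set E} (hO : IsOpen O) (hK : IsCompact K)
    (hKO : K ⊆ O) {h : E → ℝ} (hh : ContDiffOn ℝ ∞ h O) {y : Fin r → E → E}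
    (hy : ∀ i, ContDiffOn ℝ ∞ (y i) O)
    (hreg : ∀ z ∈ K, pairing h y z = 0 → Function.Surjective (fderiv ℝ (pairing h y) z)) :
    ∃ ε > 0, ∀ g : E → ℝ, ContDiffOn ℝ ∞ g O →
      (∀ z ∈ K, ∀ j ≤ 2, ‖iteratedFDeriv ℝ j g z - iteratedFDeriv ℝ j h z‖ < ε) →
      ∀ z ∈ K, pairing g y z = 0 → Function.Surjective (fderiv ℝ (pairing g y) z) := by
  -- Regularity at `z` says that the value and derivative of the pairing form a point of the open
  -- set `S`; these points fill a compact set as `z` runs over `K`, so a `δ`-thickening of it stays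
  -- in `S`.
  let S : Set ((Fin r → ℝ) × (E →L[ℝ] (Fin r → ℝ))) :=
    {p | p.1 ≠ 0} ∪ {p | Function.Surjective p.2}
  have hS : IsOpen S := (isOpen_ne.preimage continuous_fst).union
    ((ContinuousLinearMap.isOpen_setOf_surjective_of_finiteDimensional E
      (Fin r → ℝ)).preimage continuous_snd)
  have hp := contDiffOn_pairing (m := ∞) hO hh hy
  have hcont : ContinuousOn (fun z ↦ (pairing h y z, fderiv ℝ (pairing h y) z)) K :=
    (hp.continuousOn.prodMk (hp.continuousOn_fderiv_of_isOpen hO (by simp))).mono hKO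
  obtain ⟨δ, hδ, hthick⟩ := (hK.image_of_continuousOn hcont).exists_thickening_subset_open hS (by
    rintro _ ⟨z, hz, rfl⟩
    by_cases h0 : pairing h y z = 0
    · exact Or.inr (hreg z hz h0)
    · exact Or.inl h0)
  obtain ⟨B₀, hB₀⟩ := hK.exists_bound_of_continuousOn (f := fun z i ↦ y i z)
    ((continuousOn_pi.2 fun i ↦ (hy i).continuousOn).mono hKO)
  obtain ⟨B₁, hB₁⟩ := hK.exists_bound_of_continuousOn (f := fun z i ↦ fderiv ℝ (y i) z)
    ((continuousOn_pi.2 fun i ↦ (hy i).continuousOn_fderiv_of_isOpen hO (by simp)).mono hKO)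
  -- `B` bounds the fields plus their derivatives on `K`; the summand `1` allows division by it.
  -- With tolerance `δ / (2 * B)` the value and derivative of the pairing move by at most `δ / 2`.
  set B := |B₀| + |B₁| + 1
  have hB : 0 < B := by positivity
  refine ⟨δ / (2 * B), by positivity, fun g hg hsmall z hz h0 ↦ ?_⟩
  have hgz := hg.contDiffAt (hO.mem_nhds (hKO hz))
  have hhz := hh.contDiffAt (hO.mem_nhds (hKO hz))
  have hyz : ∀ i, DifferentiableAt ℝ (y i) z := fun i ↦
    ((hy i).contDiffAt (hO.mem_nhds (hKO hz))).differentiableAt (by simp)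
  have hle : (2 : WithTop ℕ∞) ≤ ∞ := WithTop.coe_le_coe.2 le_top
  have hsub : ∀ j ≤ 2, ‖iteratedFDeriv ℝ j (g - h) z‖ < δ / (2 * B) := fun j hj ↦ by
    rw [iteratedFDeriv_sub_apply (hgz.of_le (by exact_mod_cast le_top))
      (hhz.of_le (by exact_mod_cast le_top))]
    exact hsmall z hz j hj
  have hfd : ∀ᶠ u in 𝓝 z, fderiv ℝ (g - h) u = fderiv ℝ g u - fderiv ℝ h u := by
    filter_upwards [hO.mem_nhds (hKO hz)] with u hu
    exact fderiv_sub ((hg.contDiffAt (hO.mem_nhds hu)).differentiableAt (by simp))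
      ((hh.contDiffAt (hO.mem_nhds hu)).differentiableAt (by simp))
  have hD1 : ‖fderiv ℝ g z - fderiv ℝ h z‖ < δ / (2 * B) := by
    rw [← hfd.self_of_nhds, ← norm_iteratedFDeriv_one]
    exact hsub 1 (by norm_num)
  have hD2 : ‖fderiv ℝ (fderiv ℝ g) z - fderiv ℝ (fderiv ℝ h) z‖ < δ / (2 * B) := by
    have h1 : fderiv ℝ (fderiv ℝ (g - h)) z = fderiv ℝ (fderiv ℝ g) z - fderiv ℝ (fderiv ℝ h) z := by
      rw [Filter.EventuallyEq.fderiv_eq hfd]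
      exact fderiv_sub ((hgz.fderiv_right (m := ∞) (by simp)).differentiableAt (by simp))
        ((hhz.fderiv_right (m := ∞) (by simp)).differentiableAt (by simp))
    rw [← h1, ← norm_iteratedFDeriv_one, norm_iteratedFDeriv_fderiv]
    exact hsub 2 le_rfl
  set η := δ / (2 * B)
  have hη : 0 < η := by positivity
  have hyB : ∀ i, ‖y i z‖ ≤ B := fun i ↦
    ((norm_le_pi_norm (fun i ↦ y i z) i).trans (hB₀ z hz)).trans
      ((le_abs_self _).trans (by simp only [B]; linarith [abs_nonneg B₁]))
  have hyB' : ∀ i, ‖y i z‖ + ‖fderiv ℝ (y i) z‖ ≤ B := fun i ↦ by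
    have h1 := (norm_le_pi_norm (fun i ↦ y i z) i).trans (hB₀ z hz)
    have h2 := (norm_le_pi_norm (fun i ↦ fderiv ℝ (y i) z) i).trans (hB₁ z hz)
    simp only [B]
    linarith [le_abs_self B₀, le_abs_self B₁]
  have hηB : η * B < δ := by
    simp only [η]
    rw [div_mul_eq_mul_div, div_lt_iff₀ (by positivity)]
    nlinarith
  have hmem : (pairing g y z, fderiv ℝ (pairing g y) z) ∈ S := by
    refine hthick (Metric.mem_thickening_iff.2 ⟨_, ⟨z, hz, rfl⟩, ?_⟩)
    rw [Prod.dist_eq, dist_eq_norm, dist_eq_norm]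
    refine (max_le ?_ ?_).trans_lt hηB
    · refine (pi_norm_le_iff_of_nonneg (by positivity)).2 fun i ↦ ?_
      have h1 : (pairing g y z - pairing h y z) i = (fderiv ℝ g z - fderiv ℝ h z) (y i z) := rfl
      rw [h1]
      exact ((fderiv ℝ g z - fderiv ℝ h z).le_opNorm _).trans
        (mul_le_mul hD1.le (hyB i) (norm_nonneg _) hη.le)
    · refine ContinuousLinearMap.opNorm_le_bound _ (by positivity) fun v ↦ ?_
      refine (pi_norm_le_iff_of_nonneg (by positivity)).2 fun i ↦ ?_
      have h1 : (fderiv ℝ (pairing g y) z - fderiv ℝ (pairing h y) z) v i =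
          (fderiv ℝ g z - fderiv ℝ h z) (fderiv ℝ (y i) z v) +
          (fderiv ℝ (fderiv ℝ g) z - fderiv ℝ (fderiv ℝ h) z) v (y i z) := by
        rw [sub_apply, Pi.sub_apply,
          fderiv_pairing_apply (hgz.of_le hle) hyz, fderiv_pairing_apply (hhz.of_le hle) hyz]
        simp only [sub_apply]
        ring
      rw [h1]
      calc _ ≤ η * (‖fderiv ℝ (y i) z‖ * ‖v‖) + η * ‖v‖ * ‖y i z‖ := by
            refine (norm_add_le _ _).trans (add_le_add ?_ ?_)
            · exact ((fderiv ℝ g z - fderiv ℝ h z).le_opNorm _).trans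
                (mul_le_mul hD1.le ((fderiv ℝ (y i) z).le_opNorm v) (norm_nonneg _) hη.le)
            · refine ContinuousLinearMap.le_of_opNorm_le _ ?_ _
              exact ((fderiv ℝ (fderiv ℝ g) z - fderiv ℝ (fderiv ℝ h) z).le_opNorm v).trans
                (mul_le_mul_of_nonneg_right hD2.le (norm_nonneg v))
        _ = η * (‖y i z‖ + ‖fderiv ℝ (y i) z‖) * ‖v‖ := by ring
        _ ≤ η * B * ‖v‖ := by gcongr; exact hyB' i
  exact hmem.resolve_left fun hne ↦ hne h0

end Pairing

variable {n : ℕ} {M : Type*} [TopologicalSpace M]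
  [ChartedSpace (EuclideanSpace ℝ (Fin (2 * n))) M] [IsManifold (𝓡 (2 * n)) ∞ M]
  {Ω : SymplecticForm n M} {k : ℕ} (V : SymplecticDistribution Ω k)

/-- The functions which satisfy the condition of genericity at the points of `K`. -/
def SymplecticDistribution.regularOn (K : Set M) : Set C^∞⟮𝓡 (2 * n), M; 𝓘(ℝ, ℝ), ℝ⟯ :=
  {H | ∀ x ∈ K, ∀ (U : Set M) (Y : Fin (2 * k) → (x : M) → TangentSpace (𝓡 (2 * n)) x),
    IsLocalFrame V.fibre U Y → x ∈ U → frameMap Y H x = 0 →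
      Function.Surjective (mfderiv (𝓡 (2 * n)) 𝓘(ℝ, Fin (2 * k) → ℝ) (frameMap Y H) x)}

theorem SymplecticDistribution.mem_genericHamiltonians_iff
    {H : C^∞⟮𝓡 (2 * n), M; 𝓘(ℝ, ℝ), ℝ⟯} {ι : Sort*} {K : ι → Set M} (hK : ∀ x, ∃ i, x ∈ K i) :
    H ∈ V.genericHamiltonians ↔ ∀ i, H ∈ V.regularOn (K i) := by
  refine ⟨fun h i x _ U Y hY hx h0 ↦ h U Y hY x hx h0, fun h U Y hY x hx h0 ↦ ?_⟩
  obtain ⟨i, hi⟩ := hK x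
  exact h i x hi U Y hY hx h0

variable {V} {e : OpenPartialHomeomorph M (EuclideanSpace ℝ (Fin (2 * n)))} {U : Set M}
  {Y : Fin (2 * k) → (x : M) → TangentSpace (𝓡 (2 * n)) x}

theorem IsLocalFrame.mem_regularOn_iff (hY : IsLocalFrame V.fibre U Y)
    {H : C^∞⟮𝓡 (2 * n), M; 𝓘(ℝ, ℝ), ℝ⟯} {K : Set M} (hK : K ⊆ U) :
    H ∈ V.regularOn K ↔ ∀ x ∈ K, frameMap Y H x = 0 →
      Function.Surjective (mfderiv (𝓡 (2 * n)) 𝓘(ℝ, Fin (2 * k) → ℝ) (frameMap Y H) x) :=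
  ⟨fun h x hx ↦ h x hx U Y hY (hK hx), fun h x hx _ _ hY' hx' ↦
    hY.regular_of_regular hY' H (hK hx) hx' (h x hx)⟩

theorem IsLocalFrame.exists_pos_mem_regularOn (hY : IsLocalFrame V.fibre U Y)
    (he : e ∈ IsManifold.maximalAtlas (𝓡 (2 * n)) ∞ M) {K : Set M} (hK : IsCompact K)
    (hKe : K ⊆ e.source) (hKU : K ⊆ U) {H : C^∞⟮𝓡 (2 * n), M; 𝓘(ℝ, ℝ), ℝ⟯}
    (hH : H ∈ V.regularOn K) :
    ∃ ε > 0, ∀ H' : C^∞⟮𝓡 (2 * n), M; 𝓘(ℝ, ℝ), ℝ⟯, (∀ x ∈ K, ∀ j ≤ 2,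
      ‖iteratedFDeriv ℝ j (H' ∘ e.symm) (e x) - iteratedFDeriv ℝ j (H ∘ e.symm) (e x)‖ < ε) →
      H' ∈ V.regularOn K := by
  have hsm : ∀ H : C^∞⟮𝓡 (2 * n), M; 𝓘(ℝ, ℝ), ℝ⟯,
      ContDiffOn ℝ ∞ (H ∘ e.symm) (e.target ∩ e.symm ⁻¹' U) := fun H ↦
    (H.contMDiff.contDiffOn_comp_chart_symm he).mono Set.inter_subset_left
  have hfm : ∀ (H : C^∞⟮𝓡 (2 * n), M; 𝓘(ℝ, ℝ), ℝ⟯), ∀ x ∈ K,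
      pairing (H ∘ e.symm) (chartFrame e Y) (e x) = frameMap Y H x := fun H x hx ↦ by
    rw [← frameMap_comp_chart_symm he Y H (e.map_source (hKe hx)), e.left_inv (hKe hx)]
  obtain ⟨ε, hε, h⟩ := exists_pos_regular_of_isCompact (K := e '' K)
    (e.symm.isOpen_inter_preimage hY.isOpen) (hK.image_of_continuousOn (e.continuousOn.mono hKe))
    (by
      rintro _ ⟨x, hx, rfl⟩
      exact ⟨e.map_source (hKe hx), by simpa [e.left_inv (hKe hx)] using hKU hx⟩)
    (hsm H) (hY.contDiffOn_chartFrame he) (by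
      rintro _ ⟨x, hx, rfl⟩ h0
      rw [hfm H x hx] at h0
      exact (hY.mfderiv_frameMap_surjective_iff he H (hKU hx) (hKe hx)).1
        ((hY.mem_regularOn_iff hKU).1 hH x hx h0))
  refine ⟨ε, hε, fun H' hH' ↦ (hY.mem_regularOn_iff hKU).2 fun x hx h0 ↦ ?_⟩
  rw [hY.mfderiv_frameMap_surjective_iff he H' (hKU hx) (hKe hx)]
  refine h (H' ∘ e.symm) (hsm H') ?_ (e x) ⟨x, hx, rfl⟩ (by rw [hfm H' x hx, h0])
  rintro _ ⟨x, hx, rfl⟩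
  exact hH' x hx

end ConstrainedHamiltonian

/-! ### Finite-parameter perturbations and perturbation-stable sets. -/

namespace ConstrainedHamiltonian

theorem iteratedFDeriv_comp_chart_symm_congr {E M : Type*} [NormedAddCommGroup E]
    [NormedSpace ℝ E] [TopologicalSpace M] {e : OpenPartialHomeomorph M E} {f g : M → ℝ} {x : M} (hx : x ∈ e.source)
    (h : f =ᶠ[𝓝 x] g) (j : ℕ) :
    iteratedFDeriv ℝ j (f ∘ e.symm) (e x) = iteratedFDeriv ℝ j (g ∘ e.symm) (e x) := by
  have hc : Filter.Tendsto e.symm (𝓝 (e x)) (𝓝 x) := by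
    have := e.continuousAt_symm (e.map_source hx)
    rwa [ContinuousAt, e.left_inv hx] at this
  exact ((h.comp_tendsto hc).iteratedFDeriv ℝ j).eq_of_nhds

variable {n : ℕ} {M : Type*} [TopologicalSpace M]
  [ChartedSpace (EuclideanSpace ℝ (Fin (2 * n))) M]

section Perturb

/-- The perturbation of `H` by a linear combination of the functions `φ i`. -/
noncomputable def perturb {m : ℕ} (H : C^∞⟮𝓡 (2 * n), M; 𝓘(ℝ, ℝ), ℝ⟯)
    (φ : Fin m → C^∞⟮𝓡 (2 * n), M; 𝓘(ℝ, ℝ), ℝ⟯) (t : Fin m → ℝ) :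
    C^∞⟮𝓡 (2 * n), M; 𝓘(ℝ, ℝ), ℝ⟯ :=
  ⟨fun x ↦ H x + ∑ i, t i * φ i x,
    H.contMDiff.add (contMDiff_finsetSum fun i _ ↦ contMDiff_const.mul (φ i).contMDiff)⟩

variable {m : ℕ} {H : C^∞⟮𝓡 (2 * n), M; 𝓘(ℝ, ℝ), ℝ⟯}
  {φ : Fin m → C^∞⟮𝓡 (2 * n), M; 𝓘(ℝ, ℝ), ℝ⟯}

theorem perturb_apply (t : Fin m → ℝ) (x : M) : perturb H φ t x = H x + ∑ i, t i * φ i x := rfl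

theorem perturb_eventuallyEq {S : Set M} (hS : ∀ i, tsupport (φ i) ⊆ S) (t : Fin m → ℝ) {x : M}
    (hx : x ∉ S) : perturb H φ t =ᶠ[𝓝 x] H := by
  have h : ∀ i, φ i =ᶠ[𝓝 x] 0 := fun i ↦ notMem_tsupport_iff_eventuallyEq.1 fun h ↦ hx (hS i h)
  filter_upwards [Filter.eventually_all.2 h] with y hy
  simp only [Pi.zero_apply] at hy
  simp [perturb_apply, hy]

variable {e : OpenPartialHomeomorph M (EuclideanSpace ℝ (Fin (2 * n)))}

theorem iteratedFDeriv_perturb (he : e ∈ IsManifold.maximalAtlas (𝓡 (2 * n)) ∞ M)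
    (t : Fin m → ℝ) {z : EuclideanSpace ℝ (Fin (2 * n))} (hz : z ∈ e.target) (j : ℕ) :
    iteratedFDeriv ℝ j (perturb H φ t ∘ e.symm) z =
      iteratedFDeriv ℝ j (H ∘ e.symm) z + ∑ i, t i • iteratedFDeriv ℝ j (φ i ∘ e.symm) z := by
  have hat : ∀ f : C^∞⟮𝓡 (2 * n), M; 𝓘(ℝ, ℝ), ℝ⟯, ContDiffAt ℝ j (f ∘ e.symm) z := fun f ↦
    ((f.contMDiff.contDiffOn_comp_chart_symm he).contDiffAt (e.open_target.mem_nhds hz)).of_le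
      (by exact_mod_cast le_top)
  have hsm : ∀ i, ContDiffAt ℝ j (t i • (φ i ∘ e.symm)) z := fun i ↦ (hat (φ i)).const_smul (t i)
  have heq : perturb H φ t ∘ e.symm =
      H ∘ e.symm + fun z ↦ ∑ i, (t i • (φ i ∘ e.symm)) z := by
    ext z
    simp [perturb_apply]
  rw [heq, iteratedFDeriv_add_apply (hat H) (ContDiffAt.sum fun i _ ↦ hsm i),
    iteratedFDeriv_fun_sum_apply fun i _ ↦ hsm i]
  congr 1
  exact Finset.sum_congr rfl fun i _ ↦ iteratedFDeriv_const_smul_apply (hat (φ i))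

/-- A strict bound on the derivatives over a compact subset of a chart is stable under small
perturbations. -/
theorem eventually_norm_iteratedFDeriv_perturb_sub_lt
    (he : e ∈ IsManifold.maximalAtlas (𝓡 (2 * n)) ∞ M) {K : Set M} (hK : IsCompact K)
    (hKe : K ⊆ e.source) {f : C^∞⟮𝓡 (2 * n), M; 𝓘(ℝ, ℝ), ℝ⟯} {r : ℕ} {ε : ℝ}
    (hH : ∀ x ∈ K, ∀ j ≤ r, ‖iteratedFDeriv ℝ j (H ∘ e.symm) (e x) -
      iteratedFDeriv ℝ j (f ∘ e.symm) (e x)‖ < ε) :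
    ∀ᶠ t in 𝓝 (0 : Fin m → ℝ), ∀ x ∈ K, ∀ j ≤ r,
      ‖iteratedFDeriv ℝ j (perturb H φ t ∘ e.symm) (e x) -
        iteratedFDeriv ℝ j (f ∘ e.symm) (e x)‖ < ε := by
  have hcont : ∀ (f : C^∞⟮𝓡 (2 * n), M; 𝓘(ℝ, ℝ), ℝ⟯) (j : ℕ), ∀ z ∈ e.target,
      ContinuousAt (iteratedFDeriv ℝ j (f ∘ e.symm)) z := fun f j z hz ↦
    (((f.contMDiff.contDiffOn_comp_chart_symm he).contDiffAt
      (e.open_target.mem_nhds hz)).iteratedFDeriv_right (m := 0) (i := j)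
      (by simp; exact_mod_cast le_top)).continuousAt
  have key : ∀ j ∈ Set.Iic r, ∀ᶠ t in 𝓝 (0 : Fin m → ℝ), ∀ z ∈ e '' K,
      ‖iteratedFDeriv ℝ j (perturb H φ t ∘ e.symm) z - iteratedFDeriv ℝ j (f ∘ e.symm) z‖ < ε := by
    intro j hj
    -- The derivative is jointly continuous in the parameter and the point, so compactness makes the
    -- neighbourhood of `t = 0` uniform over `e '' K`.
    refine (hK.image_of_continuousOn
      (e.continuousOn.mono hKe)).eventually_forall_of_forall_eventually ?_
    rintro _ ⟨x, hx, rfl⟩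
    have hz := e.map_source (hKe hx)
    have hev : ∀ᶠ p : (Fin m → ℝ) × EuclideanSpace ℝ (Fin (2 * n)) in 𝓝 (0, e x),
        ‖iteratedFDeriv ℝ j (H ∘ e.symm) p.2 + ∑ i, p.1 i • iteratedFDeriv ℝ j (φ i ∘ e.symm) p.2 -
          iteratedFDeriv ℝ j (f ∘ e.symm) p.2‖ < ε := by
      have hc : ∀ f : C^∞⟮𝓡 (2 * n), M; 𝓘(ℝ, ℝ), ℝ⟯, ContinuousAt
          (fun p : (Fin m → ℝ) × EuclideanSpace ℝ (Fin (2 * n)) ↦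
            iteratedFDeriv ℝ j (f ∘ e.symm) p.2) (0, e x) := fun f ↦
        ContinuousAt.comp (f := Prod.snd) (hcont f j _ hz) continuousAt_snd
      have hs : ContinuousAt (fun p : (Fin m → ℝ) × EuclideanSpace ℝ (Fin (2 * n)) ↦
          ∑ i, p.1 i • iteratedFDeriv ℝ j (φ i ∘ e.symm) p.2) (0, e x) :=
        tendsto_finsetSum _ fun i _ ↦ Filter.Tendsto.smul
          (((continuous_apply i).comp continuous_fst).tendsto _) (hc (φ i))
      refine (((hc H).add hs).sub (hc f)).norm.eventually_lt continuousAt_const ?_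
      simpa using hH x hx j hj
    have hev' : ∀ᶠ p : (Fin m → ℝ) × EuclideanSpace ℝ (Fin (2 * n)) in 𝓝 (0, e x),
        p.2 ∈ e.target := continuous_snd.continuousAt.eventually_mem (e.open_target.mem_nhds hz)
    filter_upwards [hev, hev'] with p hp hp'
    rw [iteratedFDeriv_perturb he p.1 hp' j]
    exact hp
  filter_upwards [((Set.finite_Iic r).eventually_all).2 key] with t ht x hx j hj
  exact ht j hj (e x) ⟨x, hx, rfl⟩

/-- A set of functions which is stable under small compactly supported perturbations, and under
limits of sequences which are locally eventually constant. -/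
structure IsPerturbationStable (N : Set C^∞⟮𝓡 (2 * n), M; 𝓘(ℝ, ℝ), ℝ⟯) : Prop where
  perturb_mem (H : C^∞⟮𝓡 (2 * n), M; 𝓘(ℝ, ℝ), ℝ⟯) (_ : H ∈ N) (m : ℕ)
    (φ : Fin m → C^∞⟮𝓡 (2 * n), M; 𝓘(ℝ, ℝ), ℝ⟯) (S : Set M) (_ : IsCompact S)
    (_ : ∀ i, tsupport (φ i) ⊆ S) : ∀ᶠ t in 𝓝 (0 : Fin m → ℝ), perturb H φ t ∈ N
  limit_mem (H : ℕ → C^∞⟮𝓡 (2 * n), M; 𝓘(ℝ, ℝ), ℝ⟯) (F : C^∞⟮𝓡 (2 * n), M; 𝓘(ℝ, ℝ), ℝ⟯)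
    (_ : ∀ x, ∀ᶠ i in Filter.atTop, H i =ᶠ[𝓝 x] F) (_ : ∀ᶠ i in Filter.atTop, H i ∈ N) : F ∈ N

theorem IsPerturbationStable.sInter {𝒩 : Set (Set C^∞⟮𝓡 (2 * n), M; 𝓘(ℝ, ℝ), ℝ⟯)}
    (hfin : 𝒩.Finite) (h : ∀ N ∈ 𝒩, IsPerturbationStable N) : IsPerturbationStable (⋂₀ 𝒩) where
  perturb_mem H hH m φ S hS hφ := by
    simp only [Set.mem_sInter] at hH ⊢
    exact (hfin.eventually_all).2 fun N hN ↦ (h N hN).perturb_mem H (hH N hN) m φ S hS hφ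
  limit_mem H F hF hN N hNmem := (h N hNmem).limit_mem H F hF (hN.mono fun i hi ↦ hi N hNmem)

/-- Only finitely many `K i` meet the compact set `S`, and off `S` the function is unchanged. The
strict inequality passes to the limit since at each point the limit has the same germ as some member
of the sequence in the neighbourhood. -/
theorem isPerturbationStable_whitneyNhd {r : ℕ}
    {e : ℕ → OpenPartialHomeomorph M (EuclideanSpace ℝ (Fin (2 * n)))} {K : ℕ → Set M} {ε : ℕ → ℝ}
    {f : C^∞⟮𝓡 (2 * n), M; 𝓘(ℝ, ℝ), ℝ⟯}
    (he : ∀ i, e i ∈ IsManifold.maximalAtlas (𝓡 (2 * n)) ∞ M)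
    (hK : ∀ i, IsCompact (K i) ∧ K i ⊆ (e i).source) (hfin : LocallyFinite K) :
    IsPerturbationStable (whitneyNhd r e K ε f) where
  perturb_mem H hH m φ S hS hφ := by
    have hev := ((hfin.finite_nonempty_inter_compact hS).eventually_all).2 fun i _ ↦
      eventually_norm_iteratedFDeriv_perturb_sub_lt (φ := φ) (he i) (hK i).1 (hK i).2 (hH i)
    filter_upwards [hev] with t ht i x hx j hj
    by_cases hxS : x ∈ S
    · exact ht i ⟨x, hx, hxS⟩ x hx j hj
    · rw [iteratedFDeriv_comp_chart_symm_congr ((hK i).2 hx) (perturb_eventuallyEq hφ t hxS)]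
      exact hH i x hx j hj
  limit_mem H F hF hN i x hx j hj := by
    obtain ⟨l, hl, hl'⟩ := ((hF x).and hN).exists
    rw [← iteratedFDeriv_comp_chart_symm_congr ((hK i).2 hx) hl]
    exact hl' i x hx j hj

/-- Whitney neighbourhoods form only a subbasis, whence the finite intersection. -/
theorem whitneyTopology_exists_stable {O : Set C^∞⟮𝓡 (2 * n), M; 𝓘(ℝ, ℝ), ℝ⟯}
    (hO : IsOpen[whitneyTopology] O) (hH : H ∈ O) :
    ∃ N, IsPerturbationStable N ∧ H ∈ N ∧ N ⊆ O := by
  let _ : TopologicalSpace C^∞⟮𝓡 (2 * n), M; 𝓘(ℝ, ℝ), ℝ⟯ := whitneyTopology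
  obtain ⟨_, ⟨𝒩, ⟨hfin, hsub⟩, rfl⟩, hHN, hNO⟩ :=
    (TopologicalSpace.isTopologicalBasis_of_subbasis rfl).exists_subset_of_mem_open hH hO
  refine ⟨⋂₀ 𝒩, .sInter hfin fun N hN ↦ ?_, hHN, hNO⟩
  obtain ⟨r, e, K, ε, f, he, hK, hloc, -, rfl⟩ := hsub hN
  exact isPerturbationStable_whitneyNhd he hK hloc

theorem frameMap_congr {r : ℕ} {Y : Fin r → (x : M) → TangentSpace (𝓡 (2 * n)) x}
    {H H' : C^∞⟮𝓡 (2 * n), M; 𝓘(ℝ, ℝ), ℝ⟯} {x : M} (h : H =ᶠ[𝓝 x] H') :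
    frameMap Y H =ᶠ[𝓝 x] frameMap Y H' := by
  filter_upwards [h.eventuallyEq_nhds] with y hy
  have hd : mfderiv (𝓡 (2 * n)) 𝓘(ℝ, ℝ) H y = mfderiv (𝓡 (2 * n)) 𝓘(ℝ, ℝ) H' y := hy.mfderiv_eq
  ext i
  exact congrFun (congrArg DFunLike.coe hd) (Y i y)

variable [IsManifold (𝓡 (2 * n)) ∞ M] {Ω : SymplecticForm n M} {k : ℕ}
  {V : SymplecticDistribution Ω k}

theorem isPerturbationStable_regularOn {U : Set M}
    {Y : Fin (2 * k) → (x : M) → TangentSpace (𝓡 (2 * n)) x} (hY : IsLocalFrame V.fibre U Y)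
    (he : e ∈ IsManifold.maximalAtlas (𝓡 (2 * n)) ∞ M) {K : Set M} (hK : IsCompact K)
    (hKe : K ⊆ e.source) (hKU : K ⊆ U) : IsPerturbationStable (V.regularOn K) where
  perturb_mem H hH m φ S hS hφ := by
    obtain ⟨ε, hε, h⟩ := hY.exists_pos_mem_regularOn he hK hKe hKU hH
    filter_upwards [eventually_norm_iteratedFDeriv_perturb_sub_lt (f := H) (φ := φ) (H := H)
      (r := 2) he hK hKe (fun x _ j _ ↦ by rwa [sub_self, norm_zero])] with t ht
    exact h _ ht
  limit_mem H F hF hN := by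
    refine (hY.mem_regularOn_iff hKU).2 fun x hx h0 ↦ ?_
    obtain ⟨l, hl, hl'⟩ := ((hF x).and hN).exists
    have hfm := frameMap_congr (Y := Y) hl
    have := (hY.mem_regularOn_iff hKU).1 hl' x hx (hfm.eq_of_nhds.trans h0)
    rw [hY.mfderiv_frameMap_surjective_iff he _ (hKU hx) (hKe hx)] at this ⊢
    have hp : pairing (H l ∘ e.symm) (chartFrame e Y) =ᶠ[𝓝 (e x)]
        pairing (F ∘ e.symm) (chartFrame e Y) := by
      have hc : Filter.Tendsto e.symm (𝓝 (e x)) (𝓝 x) := by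
        have := e.continuousAt_symm (e.map_source (hKe hx))
        rwa [ContinuousAt, e.left_inv (hKe hx)] at this
      filter_upwards [hc.eventually hfm, e.open_target.mem_nhds (e.map_source (hKe hx))] with z h1 h2
      rwa [frameMap_comp_chart_symm he Y _ h2, frameMap_comp_chart_symm he Y _ h2] at h1
    rwa [← hp.fderiv_eq]

end Perturb

end ConstrainedHamiltonian

/-! ### Openness and density of the generic Hamiltonians. -/

namespace ConstrainedHamiltonian

variable {n : ℕ} {M : Type*} [TopologicalSpace M]
  [ChartedSpace (EuclideanSpace ℝ (Fin (2 * n))) M] [IsManifold (𝓡 (2 * n)) ∞ M]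
  {Ω : SymplecticForm n M} {k : ℕ} (V : SymplecticDistribution Ω k)

/-- Translating the normalized pairing by almost every vector makes zero a regular value. -/
theorem ae_regular_normalizedPairing_add {E : Type*} [NormedAddCommGroup E] [NormedSpace ℝ E]
    [FiniteDimensional ℝ E] {r : ℕ} {L : E →L[ℝ] (Fin r → ℝ)} {O : Set E} (hO : IsOpen O)
    {h : E → ℝ} (hh : ContDiffOn ℝ ∞ h O) {y : Fin r → E → E} (hy : ∀ i, ContDiffOn ℝ ∞ (y i) O) :
    ∀ᵐ t : Fin r → ℝ, ∀ z ∈ O, (frameMatrix L y z).IsInvertible →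
      normalizedPairing L h y z + t = 0 →
      Function.Surjective (fderiv ℝ (normalizedPairing L h y) z) := by
  have hg : ContDiffOn ℝ ∞ (normalizedPairing L h y) {z ∈ O | (frameMatrix L y z).IsInvertible} :=
    fun z hz ↦ (contDiffAt_normalizedPairing hO hh hy hz.1 hz.2).contDiffWithinAt
  have hnull := volume_image_not_surjective_fderiv_eq_zero
    (isOpen_frameMatrix_isInvertible hO hy) hg
  -- A zero of the translate by `t` is a point of value `-t`, so every bad `t` is the negative of a
  -- critical value.
  have hneg := ((Measure.measurePreserving_neg
    (volume : Measure (Fin r → ℝ))).quasiMeasurePreserving).preimage_null hnull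
  refine measure_mono_null (fun t ht ↦ ?_) hneg
  simp only [Set.mem_compl_iff, Set.mem_ofPred_eq] at ht
  push Not at ht
  obtain ⟨z, hz, hM, h0, hs⟩ := ht
  exact ⟨z, ⟨⟨hz, hM⟩, hs⟩, eq_neg_of_add_eq_zero_left h0⟩

/-- Around every point there are perturbations which are generic for almost every parameter. -/
theorem SymplecticDistribution.exists_local_perturbation [T2Space M] (x₀ : M) :
    ∃ W ∈ 𝓝 x₀, (∃ e ∈ IsManifold.maximalAtlas (𝓡 (2 * n)) ∞ M,
      ∃ (U : Set M) (Y : Fin (2 * k) → (x : M) → TangentSpace (𝓡 (2 * n)) x),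
        IsLocalFrame V.fibre U Y ∧ W ⊆ e.source ∧ W ⊆ U) ∧
      ∀ ρ : SmoothBumpFunction (𝓡 (2 * n)) x₀, ∃ φ : Fin (2 * k) → C^∞⟮𝓡 (2 * n), M; 𝓘(ℝ, ℝ), ℝ⟯,
        (∀ i, tsupport (φ i) ⊆ tsupport ρ) ∧
        ∀ K ⊆ interior {x | ρ x = 1} ∩ W, ∀ H : C^∞⟮𝓡 (2 * n), M; 𝓘(ℝ, ℝ), ℝ⟯,
          ∀ᵐ t, perturb H φ t ∈ V.regularOn K := by
  obtain ⟨U, Y, hxU, hY⟩ := V.smooth x₀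
  have he := IsManifold.chart_mem_maximalAtlas (I := 𝓡 (2 * n)) (n := ∞) x₀
  have hxe : x₀ ∈ (chartAt (EuclideanSpace ℝ (Fin (2 * n))) x₀).source := mem_chart_source _ x₀
  have hsmul : ∀ (ρ : SmoothBumpFunction (𝓡 (2 * n)) x₀) (g : M → ℝ),
      ContMDiffOn (𝓡 (2 * n)) 𝓘(ℝ, ℝ) ∞ g (chartAt (EuclideanSpace ℝ (Fin (2 * n))) x₀).source →
      ContMDiff (𝓡 (2 * n)) 𝓘(ℝ, ℝ) ∞ fun x ↦ ρ x • g x := fun ρ g hg ↦ ρ.contMDiff_smul hg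
  set e := chartAt (EuclideanSpace ℝ (Fin (2 * n))) x₀
  have hO := e.symm.isOpen_inter_preimage hY.isOpen
  have hz₀ : e x₀ ∈ e.target ∩ e.symm ⁻¹' U :=
    ⟨e.map_source hxe, by simpa [e.left_inv hxe] using hxU⟩
  obtain ⟨L, hL⟩ := exists_frameMatrix_isInvertible (hY.linearIndependent_chartFrame he hz₀)
  have hy := hY.contDiffOn_chartFrame he
  have hO' := isOpen_frameMatrix_isInvertible (L := L) hO hy
  refine ⟨e.source ∩ e ⁻¹' {z ∈ e.target ∩ e.symm ⁻¹' U |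
    (frameMatrix L (chartFrame e Y) z).IsInvertible},
    (e.isOpen_inter_preimage hO').mem_nhds ⟨hxe, hz₀, hL⟩,
    ⟨e, he, U, Y, hY, Set.inter_subset_left, ?_⟩, fun ρ ↦ ?_⟩
  · rintro x ⟨hx, ⟨-, hxU⟩, -⟩
    simpa [e.left_inv hx] using hxU
  have hLe : ∀ j, ContMDiffOn (𝓡 (2 * n)) 𝓘(ℝ, ℝ) ∞ (fun x ↦ L (e x) j) e.source := fun j ↦
    (((ContinuousLinearMap.proj (R := ℝ) (φ := fun _ : Fin (2 * k) ↦ ℝ)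
      j).comp L).contDiff.contMDiff).comp_contMDiffOn (contMDiffOn_of_mem_maximalAtlas he)
  -- The components of `L` in the chart, cut off by `ρ`; where `ρ = 1` the perturbation is exactly
  -- linear. The choice does not involve `H`.
  refine ⟨fun j ↦ ⟨fun x ↦ ρ x • L (e x) j, hsmul ρ _ (hLe j)⟩,
    fun j ↦ closure_mono (Function.support_smul_subset_left _ _), fun K hK H ↦ ?_⟩
  have hh : ContDiffOn ℝ ∞ (H ∘ e.symm) (e.target ∩ e.symm ⁻¹' U) :=
    (H.contMDiff.contDiffOn_comp_chart_symm he).mono Set.inter_subset_left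
  have hKU : K ⊆ U := fun x hx ↦ by
    obtain ⟨-, hxe, ⟨-, hxU⟩, -⟩ := hK hx
    simpa [e.left_inv hxe] using hxU
  filter_upwards [ae_regular_normalizedPairing_add (L := L) hO hh hy] with t ht
  refine (hY.mem_regularOn_iff hKU).2 fun x hx ↦ ?_
  obtain ⟨hx1, hxe, hz, hM⟩ := hK hx
  rw [hY.regular_iff_normalizedPairing he _ (hKU hx) hxe hM]
  have hc : Filter.Tendsto e.symm (𝓝 (e x)) (𝓝 x) := by
    have := e.continuousAt_symm (e.map_source hxe)
    rwa [ContinuousAt, e.left_inv hxe] at this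
  set Ht := perturb H (fun j ↦ ⟨fun x ↦ ρ x • L (e x) j, hsmul ρ _ (hLe j)⟩) t
  have h1 : Ht ∘ e.symm =ᶠ[𝓝 (e x)] fun u ↦ (H ∘ e.symm) u + ∑ j, t j * L u j := by
    filter_upwards [hc.eventually (isOpen_interior.mem_nhds hx1), e.open_target.mem_nhds hz.1]
      with u hu hue
    have hρ : e.symm u ∈ {x | ρ x = 1} := interior_subset hu
    rw [Set.mem_ofPred_eq] at hρ
    change H (e.symm u) + ∑ j, t j * (ρ (e.symm u) • L (e (e.symm u)) j) = _
    simp [hρ, e.right_inv hue]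
  have h2 : normalizedPairing L (Ht ∘ e.symm) (chartFrame e Y) =ᶠ[𝓝 (e x)]
      fun u ↦ normalizedPairing L (H ∘ e.symm) (chartFrame e Y) u + t := by
    filter_upwards [h1.eventuallyEq_nhds, hO'.mem_nhds ⟨hz, hM⟩] with u hu hu'
    rw [← normalizedPairing_add_linear hu'.2
      ((hh.contDiffAt (hO.mem_nhds hu'.1)).differentiableAt (by simp))]
    simp only [normalizedPairing]
    congr 1
    ext i
    exact congrFun (congrArg DFunLike.coe hu.fderiv_eq) _
  rw [h2.eq_of_nhds, h2.fderiv_eq, fderiv_add_const]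
  exact ht (e x) hz hM

/-- A locally finite sequence of compact sets covering `M`, with perturbations making every function
generic on each of them. -/
theorem SymplecticDistribution.exists_cover [T2Space M] [SecondCountableTopology M] [Nonempty M] :
    ∃ (K S : ℕ → Set M) (e : ℕ → OpenPartialHomeomorph M (EuclideanSpace ℝ (Fin (2 * n))))
      (U : ℕ → Set M) (Y : ℕ → Fin (2 * k) → (x : M) → TangentSpace (𝓡 (2 * n)) x)
      (φ : ℕ → Fin (2 * k) → C^∞⟮𝓡 (2 * n), M; 𝓘(ℝ, ℝ), ℝ⟯),
      LocallyFinite S ∧ (∀ x, ∃ i, x ∈ K i) ∧ ∀ i, K i ⊆ S i ∧ IsCompact (S i) ∧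
        IsCompact (K i) ∧ e i ∈ IsManifold.maximalAtlas (𝓡 (2 * n)) ∞ M ∧
        IsLocalFrame V.fibre (U i) (Y i) ∧ K i ⊆ (e i).source ∧ K i ⊆ U i ∧
        (∀ j, tsupport (φ i j) ⊆ S i) ∧
        ∀ H : C^∞⟮𝓡 (2 * n), M; 𝓘(ℝ, ℝ), ℝ⟯, ∀ᵐ t, perturb H (φ i) t ∈ V.regularOn (K i) := by
  have : LocallyCompactSpace M := ChartedSpace.locallyCompactSpace (EuclideanSpace ℝ (Fin (2 * n))) M
  choose W hW hframe hpert using V.exists_local_perturbation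
  choose e he U Y hY hWe hWU using hframe
  choose φ hφS hφ using hpert
  obtain ⟨ι, f, hf⟩ := SmoothBumpCovering.exists_isSubordinate (𝓡 (2 * n)) (s := Set.univ)
    isClosed_univ (fun x _ ↦ hW x)
  have hsub : ∀ i, {x | f i x = 1} ⊆ Function.support (f i) := fun i x hx ↦ by
    have h1 : f i x = 1 := hx
    simp [h1]
  -- The shrinking lemma gives closed sets inside the regions where the bump functions are locally
  -- `1`; being inside the supports, they are compact.
  obtain ⟨K, hKU, hKc, hKsub⟩ := exists_iUnion_eq_closed_subset
    (u := fun i ↦ interior {x | f i x = 1}) (fun i ↦ isOpen_interior)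
    (fun x ↦ (f.point_finite x).subset fun i hi ↦ hsub i (interior_subset hi))
    (Set.eq_univ_of_forall fun x ↦ Set.mem_iUnion.2 ⟨f.ind x trivial,
      mem_interior_iff_mem_nhds.2 (f.eventuallyEq_one x trivial)⟩)
  have hKt : ∀ i, K i ⊆ tsupport (f i) := fun i x hx ↦
    subset_tsupport _ (hsub i (interior_subset (hKsub i hx)))
  have hKW : ∀ i, K i ⊆ W (f.c i) := fun i ↦ (hKt i).trans (hf i)
  have hScpt : ∀ i, IsCompact (tsupport (f i)) := fun i ↦ (f i).hasCompactSupport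
  have : Countable ι := Set.countable_univ_iff.1 (f.locallyFinite.countable_univ
    fun i ↦ (f i).nonempty_support)
  obtain ⟨x₀⟩ := ‹Nonempty M›
  let _ := Encodable.ofCountable ι
  let c : ℕ → M := fun m ↦ (Encodable.decode₂ ι m).elim x₀ f.c
  -- Indices that code no bump function get empty sets and zero functions; their chart and frame,
  -- taken at `x₀`, are arbitrary.
  refine ⟨fun m ↦ (Encodable.decode₂ ι m).elim ∅ K,
    fun m ↦ (Encodable.decode₂ ι m).elim ∅ fun i ↦ tsupport (f i),
    fun m ↦ e (c m), fun m ↦ U (c m), fun m ↦ Y (c m),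
    fun m ↦ (Encodable.decode₂ ι m).elim (fun _ ↦ 0) fun i ↦ φ (f.c i) (f i), ?_, ?_, ?_⟩
  · intro x
    obtain ⟨t, ht, hfin⟩ := f.locallyFinite.closure x
    refine ⟨t, ht, (hfin.image Encodable.encode).subset ?_⟩
    rintro m ⟨y, hy, hyt⟩
    rcases hm : Encodable.decode₂ ι m with _ | i
    · simp [hm] at hy
    · simp only [hm, Option.elim_some] at hy
      exact ⟨i, ⟨y, hy, hyt⟩, Encodable.mem_decode₂.1 hm⟩
  · intro x
    obtain ⟨i, hi⟩ := Set.mem_iUnion.1 (hKU.symm ▸ Set.mem_univ x : x ∈ ⋃ i, K i)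
    exact ⟨Encodable.encode i, by simpa [Encodable.decode₂_encode] using hi⟩
  · intro m
    beta_reduce
    rcases hm : Encodable.decode₂ ι m with _ | i
    · simp only [Option.elim_none, Set.empty_subset, isCompact_empty, he, hY, true_and]
      refine ⟨fun j ↦ ?_, fun H ↦ Filter.Eventually.of_forall fun t x hx ↦ hx.elim⟩
      simp
    · have hc : c m = f.c i := by simp [c, hm]
      rw [hc]
      simp only [Option.elim_some]
      exact ⟨hKt i, hScpt i, (hScpt i).of_isClosed_subset (hKc i) (hKt i), he _, hY _,
        (hKW i).trans (hWe _), (hKW i).trans (hWU _), hφS _ _,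
        hφ _ _ _ (Set.subset_inter (hKsub i) (hKW i))⟩

/-- Genericity is an open condition in the Whitney topology. -/
theorem SymplecticDistribution.isOpen_genericHamiltonians [T2Space M] [SecondCountableTopology M] :
    IsOpen[whitneyTopology] V.genericHamiltonians := by
  rcases isEmpty_or_nonempty M with hM | hM
  · have : V.genericHamiltonians = Set.univ :=
      Set.eq_univ_of_forall fun H U Y _ x ↦ hM.elim x
    rw [this]
    exact @isOpen_univ _ whitneyTopology
  obtain ⟨K, S, e, U, Y, _, hS, hcov, h⟩ := V.exists_cover
  refine (@isOpen_iff_forall_mem_open _ whitneyTopology _).2 fun H hH ↦ ?_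
  have hreg := (V.mem_genericHamiltonians_iff hcov).1 hH
  have hpos := fun i ↦ (h i).2.2.2.2.1.exists_pos_mem_regularOn (h i).2.2.2.1 (h i).2.2.1
    (h i).2.2.2.2.2.1 (h i).2.2.2.2.2.2.1 (hreg i)
  choose ε hε hεH using hpos
  refine ⟨whitneyNhd 2 e K ε H,
    fun H' hH' ↦ (V.mem_genericHamiltonians_iff hcov).2 fun i ↦ hεH i H' (hH' i), ?_, ?_⟩
  · exact TopologicalSpace.GenerateOpen.basic _ ⟨2, e, K, ε, H, fun i ↦ (h i).2.2.2.1,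
      fun i ↦ ⟨(h i).2.2.1, (h i).2.2.2.2.2.1⟩, hS.subset fun i ↦ (h i).1, hε, rfl⟩
  · intro i x _ j _
    rw [sub_self, norm_zero]
    exact hε i

/-- A nonempty perturbation stable set contains generic functions. -/
theorem SymplecticDistribution.exists_mem_genericHamiltonians [T2Space M]
    [SecondCountableTopology M] {N : Set C^∞⟮𝓡 (2 * n), M; 𝓘(ℝ, ℝ), ℝ⟯}
    (hN : IsPerturbationStable N) {H₀ : C^∞⟮𝓡 (2 * n), M; 𝓘(ℝ, ℝ), ℝ⟯} (hH₀ : H₀ ∈ N) :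
    ∃ H ∈ N, H ∈ V.genericHamiltonians := by
  rcases isEmpty_or_nonempty M with hM | hM
  · exact ⟨H₀, hH₀, fun U Y _ x ↦ hM.elim x⟩
  obtain ⟨K, S, e, U, Y, φ, hS, hcov, h⟩ := V.exists_cover
  have hstable : ∀ i, IsPerturbationStable (V.regularOn (K i)) := fun i ↦
    isPerturbationStable_regularOn (h i).2.2.2.2.1 (h i).2.2.2.1 (h i).2.2.1
      (h i).2.2.2.2.2.1 (h i).2.2.2.2.2.2.1
  let Inv : ℕ → Set C^∞⟮𝓡 (2 * n), M; 𝓘(ℝ, ℝ), ℝ⟯ := fun m ↦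
    {H | H ∈ N ∧ ∀ j < m, H ∈ V.regularOn (K j)}
  have step : ∀ (m : ℕ) (H : Inv m), ∃ H' : Inv (m + 1), ∀ x ∉ S m, H'.1 x = H.1 x := by
    rintro m ⟨H, hHN, hHK⟩
    have h1 := hN.perturb_mem H hHN (2 * k) (φ m) (S m) (h m).2.1 (h m).2.2.2.2.2.2.2.1
    have h2 := ((Set.finite_Iio m).eventually_all).2 fun j hj ↦
      (hstable j).perturb_mem H (hHK j hj) (2 * k) (φ m) (S m) (h m).2.1 (h m).2.2.2.2.2.2.2.1
    -- A set of full measure is dense, so an admissible `t` exists arbitrarily near `0`, where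
    -- membership in `N` and regularity on the earlier `K j` persist.
    obtain ⟨t, ⟨ht1, ht2⟩, ht3⟩ := (mem_closure_iff_nhds.1
      (Measure.dense_of_ae ((h m).2.2.2.2.2.2.2.2 H) 0)) _ (h1.and h2)
    refine ⟨⟨perturb H (φ m) t, ht1, fun j hj ↦ ?_⟩, fun x hx ↦
      (perturb_eventuallyEq (h m).2.2.2.2.2.2.2.1 t hx).eq_of_nhds⟩
    rcases (Nat.lt_succ_iff.1 hj).lt_or_eq with hj | rfl
    · exact ht2 j hj
    · exact ht3
  choose next hnext using step
  let seq : ∀ m, Inv m := fun m ↦ Nat.rec ⟨H₀, hH₀, fun j hj ↦ absurd hj (Nat.not_lt_zero j)⟩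
    next m
  have hseq : ∀ m, ∀ x ∉ S m, (seq (m + 1)).1 x = (seq m).1 x := fun m ↦ hnext m (seq m)
  -- Step `m` changes the function only on `S m`, so near each point only finitely many steps act
  -- and the sequence is eventually constant there.
  have hloc : LocallyFinite fun m ↦ {x | (seq (m + 1)).1 x ≠ (seq m).1 x} :=
    hS.subset fun m x hx ↦ by_contra fun hxS ↦ hx (hseq m x hxS)
  obtain ⟨F, hF⟩ := LocallyFinite.exists_forall_eventually_atTop_eventuallyEq
    (f := fun m x ↦ (seq m).1 x) hloc
  have hFsm : ContMDiff (𝓡 (2 * n)) 𝓘(ℝ, ℝ) ∞ F := fun x ↦ by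
    obtain ⟨m, hm⟩ := (hF x).exists
    exact (seq m).1.contMDiff.contMDiffAt.congr_of_eventuallyEq hm.symm
  let F' : C^∞⟮𝓡 (2 * n), M; 𝓘(ℝ, ℝ), ℝ⟯ := ⟨F, hFsm⟩
  refine ⟨F', hN.limit_mem (fun m ↦ (seq m).1) F' hF (.of_forall fun m ↦ (seq m).2.1),
    (V.mem_genericHamiltonians_iff hcov).2 fun j ↦ (hstable j).limit_mem (fun m ↦ (seq m).1) F' hF ?_⟩
  filter_upwards [Filter.eventually_gt_atTop j] with m hm
  exact (seq m).2.2 j hm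

/-- Generic functions are dense in the Whitney topology. -/
theorem SymplecticDistribution.dense_genericHamiltonians [T2Space M] [SecondCountableTopology M] :
    @Dense _ whitneyTopology V.genericHamiltonians := by
  intro H₀
  refine (@mem_closure_iff _ whitneyTopology _ _).2 fun O hO hH₀ ↦ ?_
  obtain ⟨N, hN, hHN, hNO⟩ := whitneyTopology_exists_stable hO hH₀
  obtain ⟨H, hH, hgen⟩ := V.exists_mem_genericHamiltonians hN hHN
  exact ⟨H, hNO hH, hgen⟩

/-- Ensures that the truncated difference satisfies `2 * (n - k) + 2 * k = 2 * n`. A point is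
required: on an empty manifold `k` may exceed `n`. -/
theorem SymplecticDistribution.rank_le (V : SymplecticDistribution Ω k) (x : M) : k ≤ n := by
  obtain ⟨U, Y, hxU, hY⟩ := V.smooth x
  have h := (hY.linearIndependent x hxU).fintype_card_le_finrank
  have hd : finrank ℝ (TangentSpace (𝓡 (2 * n)) x) = 2 * n := finrank_euclideanSpace_fin
  rw [Fintype.card_fin, hd] at h
  omega

theorem IsLocalFrame.isSmoothSubmanifold {V : SymplecticDistribution Ω k} {U : Set M}
    {Y : Fin (2 * k) → (x : M) → TangentSpace (𝓡 (2 * n)) x} (hY : IsLocalFrame V.fibre U Y)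
    (H : C^∞⟮𝓡 (2 * n), M; 𝓘(ℝ, ℝ), ℝ⟯) {c : Fin (2 * k) → ℝ}
    (hc : IsRegularValueOn (n := n) (frameMap Y H) U c) :
    IsSmoothSubmanifold (n := n) (2 * (n - k)) {x ∈ U | frameMap Y H x = c} := by
  intro x hx
  have := V.rank_le x
  exact isSmoothSubmanifold_of_isRegularValueOn (by omega) hY.isOpen
    (hY.contMDiffOn_frameMap H) hc x hx

end ConstrainedHamiltonian

theorem mainTheorem2 (n k : ℕ) {M : Type*} [TopologicalSpace M] [T2Space M]
    [SecondCountableTopology M] [ChartedSpace (EuclideanSpace ℝ (Fin (2 * n))) M]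
    [IsManifold (𝓡 (2 * n)) ∞ M]
    (Ω : ConstrainedHamiltonian.SymplecticForm n M)
    (V : ConstrainedHamiltonian.SymplecticDistribution Ω k) :
    -- the local description of the critical set and Sard's theorem for it, for every Hamiltonian
    (∀ (H : C^∞⟮𝓡 (2 * n), M; 𝓘(ℝ, ℝ), ℝ⟯) (U : Set M)
        (Y : Fin (2 * k) → (x : M) → TangentSpace (𝓡 (2 * n)) x),
      ConstrainedHamiltonian.IsLocalFrame V.fibre U Y →
        V.criticalSet H ∩ U = {x ∈ U | ConstrainedHamiltonian.frameMap Y H x = 0} ∧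
        (∀ᵐ c : Fin (2 * k) → ℝ, ConstrainedHamiltonian.IsRegularValueOn (n := n)
          (ConstrainedHamiltonian.frameMap Y H) U c) ∧
        ∀ c : Fin (2 * k) → ℝ,
          ConstrainedHamiltonian.IsRegularValueOn (n := n)
            (ConstrainedHamiltonian.frameMap Y H) U c →
          ConstrainedHamiltonian.IsSmoothSubmanifold (n := n) (2 * (n - k))
            {x ∈ U | ConstrainedHamiltonian.frameMap Y H x = c}) ∧
    -- the generic Hamiltonians are open and dense in the Whitney topology
    IsOpen[ConstrainedHamiltonian.whitneyTopology] V.genericHamiltonians ∧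
    @Dense _ ConstrainedHamiltonian.whitneyTopology V.genericHamiltonians ∧
    -- the critical set of a generic Hamiltonian is a submanifold
    ∀ H ∈ V.genericHamiltonians,
      ConstrainedHamiltonian.IsSmoothSubmanifold (n := n) (2 * (n - k)) (V.criticalSet H) := by
  refine ⟨fun H U Y hY ↦ ⟨V.criticalSet_inter_eq H hY,
    ConstrainedHamiltonian.ae_isRegularValueOn hY.isOpen (hY.contMDiffOn_frameMap H),
    fun c hc ↦ hY.isSmoothSubmanifold H hc⟩,
    V.isOpen_genericHamiltonians, V.dense_genericHamiltonians, fun H hH ↦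
    ConstrainedHamiltonian.isSmoothSubmanifold_of_locally fun x _ ↦ ?_⟩
  obtain ⟨U, Y, hxU, hY⟩ := V.smooth x
  refine ⟨U, hY.isOpen, hxU, ?_⟩
  rw [V.criticalSet_inter_eq H hY]
  exact hY.isSmoothSubmanifold H (hH U Y hY)
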